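/- Let $K$ be a field, $\varphi$ a (ring) endomorphism of $K$, and $R:=K[t;\varphi]$ the skew polynomial ring with elements $\sum_i t^i a_i$ ($a_i\in K$) and $at=t\,\varphi(a)$ for $a\in K$. Modules are right $R$-modules, and $\mathrm{ann}_M(r):=\{x\in M : x.r=0\}$ for $r\in R$. Definitions. A $K$-chain is a linear order $\Delta$ with maximum $\infty$ and maps $\gamma\mapsto\gamma\cdot a$ ($a\in K$) such that, for $a,b\in K^\times$ and $\gamma,\delta\in\Delta\setminus\{\infty\}$: $\gamma>\delta\Rightarrow\gamma\cdot a>\delta\cdot a$; $\gamma\cdot ab=(\gamma\cdot a)\cdot b$; $\gamma\cdot a>\gamma\Rightarrow\delta\cdot a>\delta$; $\gamma\cdot(a\pm b)\ge\min\{\gamma\cdot a,\gamma\cdot b\}$; and $\gamma\cdot 0=\infty$, $\gamma\cdot 1=\gamma$ for all $\gamma\in\Delta$, $\infty\cdot b=\infty$ for all $b\in K$. An $R$-chain is such a $\Delta$ with maps $\gamma\mapsto\gamma\cdot r$ ($r\in R$) extending those of $K$, such that: $\cdot t$ is a strictly increasing map of $\Delta\setminus\{\infty\}$ into itself and $\infty\cdot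 t=\infty$; $\gamma\cdot ta=(\gamma\cdot t)\cdot a$ and $\gamma\cdot t^na=(\gamma\cdot t^{n-1})\cdot ta$ for $n\ge1$, $a\in K$; for $r\ne0$, $\gamma\cdot r$ is the minimum of the $\gamma\cdot m$ over the monomials $m=t^ia_i$ ($a_i\neq 0$) of $r$; and for nonzero monomials $m_1,m_2$ with $\deg m_2<\deg m_1$ and $\gamma\ne\infty$, $\gamma\cdot m_1\le\gamma\cdot m_2$ implies $\delta\cdot m_1<\delta\cdot m_2$ for all $\delta<\gamma$. A valued $R$-module is an $R$-module $M$ with an $R$-chain $\Delta$ and a surjection $v:M\to\Delta$ such that $v(x)=\infty\Leftrightarrow x=0$, $v(x-y)\ge\min\{v(x),v(y)\}$, $v(x.a)=v(x)\cdot a$ for $a\in K$ and $v(x.t)=v(x)\cdot t$. It is trivially valued if $|v(M)|\le2$. A $C$-relation on a set is a ternary relation $C$ such that, for all $x,y,z,w$: $C(x,y,z)\Rightarrow C(x,z,y)$; $C(x,y,z)\Rightarrow\neg C(y,x,z)$; $C(x,y,z)\Rightarrow C(w,y,z)\vee C(x,w,z)$; $x\ne y\Rightarrow C(x,y,y)$.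 A structure expanding a $C$-relation is $C$-minimal if in every structure $U'$ elementarily equivalent to it, every subset of $U'$ definable with parameters is definable, with parameters, by a quantifier-free formula in the language $\{C\}$. A structure is strongly minimal if in every structure elementarily equivalent to it, every subset definable with parameters is finite or cofinite. A valued $R$-module $(M,v)$ is called $C$-minimal if it is so as a structure in the language $\{0,+,-,(\cdot r)_{r\in R},C\}$, where $C(x,y,z)\Leftrightarrow v(x-y)=v(x-z)<v(y-z)$; $M$ is called strongly minimal if it is so as a structure in the language $\{0,+,-,(\cdot r)_{r\in R}\}$. Theorem. Let $(M,v)$ be an infinite trivially valued $R$-module. Then $(M,v)$ is $C$-minimal if and only if $M$ is strongly minimal. Moreover $(M,v)$ is $C$-minimal if and only if one of the following conditions holds: 1. $M$ is divisible (i.e. $M.r=M$ for every $r\in R\setminus\{0\}$), and $\mathrm{ann}_M(r)$ is finite for every $r\in R\setminus\{0\}$; 2. the (two-sided) annihilator ideal $\{q\in R : x.q=0\ \text{for all } x\in M\}$ is equal to $rR$ for some irreducible $r\in R$, the quotient ring $R/rR$ is a (not necessarily commutative) field, and $M$ is an $R/rR$-vector space, i.e. the $R$-action on $M$ comes from a right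 $R/rR$-vector space structure. -/

import Mathlib

open MulOpposite

universe u v w a b

noncomputable section

/-! ### The skew polynomial ring `K[t;φ]`, with `a t = t φ(a)` -/

/-- A copy of the field `K`, on which `Multiplicative ℕ` acts through the powers of `φ`. -/
def TwistedField {K : Type u} [Field K] (_φ : K →+* K) : Type u := K

namespace TwistedField

variable {K : Type u} [Field K] (φ : K →+* K)

instance : Field (TwistedField φ) := inferInstanceAs (Field K)

instance : MulSemiringAction (Multiplicative ℕ) (TwistedField φ) :=
  MulSemiringAction.compHom K (powersHom (K →+* K) φ)

/-- The identity map from `K` to its copy. -/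
def of : K ≃+* TwistedField φ := RingEquiv.refl K

end TwistedField

/-- The ring `K[t;φ]` with the rule `a t = t φ(a)`. In Mathlib's `SkewPolynomial` the rule is
`X a = φ(a) X`, so that `K[t;φ]` is its opposite ring. -/
abbrev SkewPoly {K : Type u} [Field K] (φ : K →+* K) : Type u :=
  (SkewPolynomial (TwistedField φ))ᵐᵒᵖ

namespace SkewPoly

variable {K : Type u} [Field K] (φ : K →+* K)

/-- The constant polynomial `a`. -/
def const (a : K) : SkewPoly φ := op (SkewPolynomial.C (TwistedField.of φ a))

/-- The indeterminate `t`. -/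
def t : SkewPoly φ := op SkewPolynomial.X

/-- The coefficient `aᵢ` in `r = ∑ tⁱ aᵢ`. -/
def coeff {φ : K →+* K} (r : SkewPoly φ) (i : ℕ) : K :=
  (TwistedField.of φ).symm (SkewPolynomial.coeff (unop r) i)

/-- The set of the exponents `i` with `aᵢ ≠ 0` in `r = ∑ tⁱ aᵢ`. -/
def support {φ : K →+* K} (r : SkewPoly φ) : Finset ℕ := SkewPolynomial.support (unop r)

theorem const_mul_t (a : K) : const φ a * t φ = t φ * const φ (φ a) := by
  have h : (Multiplicative.ofAdd 1 : Multiplicative ℕ) • (TwistedField.of φ a)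
      = TwistedField.of φ (φ a) := by
    change (powersHom (K →+* K) φ (Multiplicative.ofAdd 1)) a = φ a
    simp
  unfold const t
  rw [← op_mul, ← op_mul, ← SkewPolynomial.monomial_zero_left, SkewPolynomial.X_mul_monomial,
    ← SkewPolynomial.monomial_zero_left, SkewPolynomial.monomial_mul_X]
  exact congrArg _ (congrArg _ h)

theorem eq_sum (r : SkewPoly φ) : r = ∑ i ∈ r.support, t φ ^ i * const φ (r.coeff i) := by
  apply unop_injective
  rw [Finset.unop_sum]
  have h := SkewPolynomial.sum_monomial (unop r)
  rw [SkewPolynomial.sum_def] at h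
  conv_lhs => rw [← h]
  refine Finset.sum_congr rfl fun i _ => ?_
  rw [← SkewPolynomial.C_mul_X_pow_eq_monomial]
  rfl

end SkewPoly

/-! ### Right modules

A right `R`-module is a module over `Rᵐᵒᵖ`, and `x.r` is `op r • x`. -/

section RightModules

variable (R : Type u) [Ring R] (M : Type v) [AddCommGroup M] [Module Rᵐᵒᵖ M]

variable {R} in
/-- `ann_M(r) = {x ∈ M | x.r = 0}`. -/
def ann (r : R) : Set M := {x | op r • x = 0}

/-- `M` is divisible: `M.r = M` for every `r ≠ 0`. -/
def IsDivisibleModule : Prop := ∀ r : R, r ≠ 0 → ∀ y : M, ∃ x : M, op r • x = y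

/-- The annihilator `{q ∈ R | x.q = 0 for all x ∈ M}` of `M`, a two-sided ideal of `R`. -/
def annihilatorIdeal : TwoSidedIdeal R :=
  TwoSidedIdeal.mk' {q : R | ∀ x : M, op q • x = 0}
    (fun x => by simp)
    (fun {p q} hp hq x => by simp [add_smul, hp x, hq x])
    (fun {p} hp x => by simp [neg_smul, hp x])
    (fun {p q} hq x => by rw [op_mul, mul_smul]; exact hq _)
    (fun {p q} hp x => by rw [op_mul, mul_smul, hp x, smul_zero])

theorem mem_annihilatorIdeal (q : R) :
    q ∈ annihilatorIdeal R M ↔ ∀ x : M, op q • x = 0 := by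
  simp [annihilatorIdeal, TwoSidedIdeal.mem_mk']

end RightModules

/-- `D` is a (not necessarily commutative) field. -/
def IsSkewField (D : Type u) [Ring D] : Prop := Nontrivial D ∧ ∀ x : D, x ≠ 0 → IsUnit x

/-- The annihilator of `M` is the right ideal `rR` for an irreducible `r`, the quotient `R/rR` is a
skew field, and the action of `R` on `M` is induced by an `R/rR`-vector space structure. -/
def IsVectorSpaceModuloIrreducible (R : Type u) [Ring R] (M : Type v) [AddCommGroup M]
    [Module Rᵐᵒᵖ M] : Prop :=
  ∃ r : R, Irreducible r ∧ (∀ q : R, q ∈ annihilatorIdeal R M ↔ ∃ s : R, q = r * s) ∧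
    IsSkewField (annihilatorIdeal R M).ringCon.Quotient ∧
    ∃ _ : Module ((annihilatorIdeal R M).ringCon.Quotient)ᵐᵒᵖ M,
      ∀ (q : R) (x : M), op ((annihilatorIdeal R M).ringCon.mk' q) • x = op q • x

/-! ### `K`-chains, `R`-chains, valued modules -/

section Chains

variable {K : Type u} [Field K] {Δ : Type w} [LinearOrder Δ] [OrderTop Δ]

/-- A `K`-chain: the linear order `Δ` with maximum `∞ = ⊤` and action `γ · a = act γ a`. -/
structure IsKChain (act : Δ → K → Δ) : Prop where
  strictMono : ∀ a : K, a ≠ 0 → ∀ γ δ : Δ, γ ≠ ⊤ → δ ≠ ⊤ → δ < γ → act δ a < act γ a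
  mul : ∀ a b : K, a ≠ 0 → b ≠ 0 → ∀ γ : Δ, γ ≠ ⊤ → act γ (a * b) = act (act γ a) b
  lt_act : ∀ a : K, a ≠ 0 → ∀ γ δ : Δ, γ ≠ ⊤ → δ ≠ ⊤ → γ < act γ a → δ < act δ a
  min_le_add : ∀ a b : K, a ≠ 0 → b ≠ 0 → ∀ γ : Δ, γ ≠ ⊤ →
    min (act γ a) (act γ b) ≤ act γ (a + b)
  min_le_sub : ∀ a b : K, a ≠ 0 → b ≠ 0 → ∀ γ : Δ, γ ≠ ⊤ →
    min (act γ a) (act γ b) ≤ act γ (a - b)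
  act_zero : ∀ γ : Δ, act γ 0 = ⊤
  act_one : ∀ γ : Δ, act γ 1 = γ
  top_act : ∀ b : K, act ⊤ b = ⊤

/-- An `R`-chain for `R = K[t;φ]`, with `γ · r = act γ r`. The map `γ ↦ γ · t` fixes `∞` and is a
strictly increasing map from `Δ \ {∞}` to itself. -/
structure IsRChain {φ : K →+* K} (act : Δ → SkewPoly φ → Δ) : Prop where
  kChain : IsKChain fun γ a => act γ (SkewPoly.const φ a)
  t_strictMono : ∀ γ δ : Δ, γ ≠ ⊤ → δ ≠ ⊤ → γ < δ →
    act γ (SkewPoly.t φ) < act δ (SkewPoly.t φ)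
  t_ne_top : ∀ γ : Δ, γ ≠ ⊤ → act γ (SkewPoly.t φ) ≠ ⊤
  top_t : act ⊤ (SkewPoly.t φ) = ⊤
  t_mul_const : ∀ (γ : Δ) (a : K),
    act γ (SkewPoly.t φ * SkewPoly.const φ a) = act (act γ (SkewPoly.t φ)) (SkewPoly.const φ a)
  t_pow_mul_const : ∀ (γ : Δ) (n : ℕ) (a : K),
    act γ (SkewPoly.t φ ^ (n + 1) * SkewPoly.const φ a) =
      act (act γ (SkewPoly.t φ ^ n)) (SkewPoly.t φ * SkewPoly.const φ a)
  /-- `γ · r` is the minimum of the `γ · tⁱaᵢ` over the monomials of `r = ∑ tⁱ aᵢ ≠ 0`. -/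
  act_eq_min : ∀ (γ : Δ) (r : SkewPoly φ), r ≠ 0 →
    act γ r = r.support.inf fun i => act γ (SkewPoly.t φ ^ i * SkewPoly.const φ (r.coeff i))
  lt_of_monomial_le : ∀ (m n : ℕ) (a b : K), a ≠ 0 → b ≠ 0 → n < m → ∀ γ : Δ, γ ≠ ⊤ →
    act γ (SkewPoly.t φ ^ m * SkewPoly.const φ a) ≤
      act γ (SkewPoly.t φ ^ n * SkewPoly.const φ b) →
    ∀ δ : Δ, δ < γ → act δ (SkewPoly.t φ ^ m * SkewPoly.const φ a) <
      act δ (SkewPoly.t φ ^ n * SkewPoly.const φ b)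

end Chains

/-- A structure of valued `K[t;φ]`-module `(M, Δ, v)` on the right `K[t;φ]`-module `M`. -/
structure ValuedModule {K : Type u} [Field K] (φ : K →+* K) (M : Type v) [AddCommGroup M]
    [Module (SkewPoly φ)ᵐᵒᵖ M] (Δ : Type w) [LinearOrder Δ] [OrderTop Δ] where
  /-- The action `γ · r` of `K[t;φ]` on the chain `Δ`. -/
  act : Δ → SkewPoly φ → Δ
  isRChain : IsRChain act
  /-- The valuation. -/
  val : M → Δ
  val_surjective : Function.Surjective val
  val_eq_top : ∀ x : M, val x = ⊤ ↔ x = 0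
  min_le_val_sub : ∀ x y : M, min (val x) (val y) ≤ val (x - y)
  val_const : ∀ (x : M) (a : K),
    val (op (SkewPoly.const φ a) • x) = act (val x) (SkewPoly.const φ a)
  val_t : ∀ x : M, val (op (SkewPoly.t φ) • x) = act (val x) (SkewPoly.t φ)

/-! ### Languages and structures -/

/-- The function symbols `0`, `-`, `+` and `x ↦ x.r` for `r ∈ R`. -/
inductive ModuleFunc (R : Type u) : ℕ → Type u
  | zero : ModuleFunc R 0
  | neg : ModuleFunc R 1
  | smul (r : R) : ModuleFunc R 1
  | add : ModuleFunc R 2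

/-- The language `{0, -, +, (·r)_{r ∈ R}}` of right `R`-modules. -/
def moduleLang (R : Type u) : FirstOrder.Language.{u, 0} := ⟨ModuleFunc R, fun _ => Empty⟩

instance moduleStructure (R : Type u) [Ring R] (M : Type v) [AddCommGroup M] [Module Rᵐᵒᵖ M] :
    (moduleLang R).Structure M where
  funMap f := match f with
    | ModuleFunc.zero => fun _ => 0
    | ModuleFunc.neg => fun x => -x 0
    | ModuleFunc.smul r => fun x => op r • x 0
    | ModuleFunc.add => fun x => x 0 + x 1
  RelMap r := r.elim

/-- The only relation symbol, of arity 3. -/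
inductive CRelSymbol : ℕ → Type
  | C : CRelSymbol 3

/-- The language `{C}` with one ternary relation symbol. -/
def cLang : FirstOrder.Language.{0, 0} := ⟨fun _ => Empty, CRelSymbol⟩

/-- The `{C}`-structure given by a ternary relation. -/
abbrev cStructure {U : Type v} (C : U → U → U → Prop) : cLang.Structure U where
  funMap f := f.elim
  RelMap r := match r with
    | CRelSymbol.C => fun x => C (x 0) (x 1) (x 2)

/-- The ternary relation interpreting `C` in a `{C}`-structure. -/
def cRel (U : Type v) [cLang.Structure U] (x y z : U) : Prop :=
  FirstOrder.Language.Structure.RelMap (L := cLang) CRelSymbol.C ![x, y, z]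

/-- The axioms of `C`-relations. -/
structure IsCRelation {U : Type v} (C : U → U → U → Prop) : Prop where
  symm : ∀ x y z, C x y z → C x z y
  asymm : ∀ x y z, C x y z → ¬ C y x z
  trans : ∀ x y z w, C x y z → C w y z ∨ C x w z
  of_ne : ∀ x y, x ≠ y → C x y y

/-! ### Strong minimality and `C`-minimality -/

/-- `S` is definable, with parameters and without quantifiers, in the language `{C}`. -/
def IsQFDefinableFromC {U : Type v} [cLang.Structure U] (S : Set U) : Prop :=
  ∃ ψ : cLang.Formula (U ⊕ Unit),
    ψ.IsQF ∧ S = {x : U | ψ.Realize (Sum.elim id fun _ => x)}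

/-- `U` is strongly minimal: in every structure elementarily equivalent to `U`, every subset
definable with parameters is finite or cofinite. -/
def IsStronglyMinimal (L : FirstOrder.Language.{a, b}) (U : Type v) [L.Structure U] : Prop :=
  ∀ (U' : Type (max a b v)) [L.Structure U'], L.ElementarilyEquivalent U U' →
    ∀ S : Set U', (Set.univ : Set U').Definable₁ L S → S.Finite ∨ Sᶜ.Finite

/-- The `{C}`-structure underlying a structure in a language `L ∪ {C}`. -/
abbrev cReduct (L : FirstOrder.Language.{a, b}) (U : Type v) [(L.sum cLang).Structure U] :
    cLang.Structure U :=
  FirstOrder.Language.LHom.sumInr.reduct (L' := L.sum cLang) U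

/-- `U`, a structure in a language `L ∪ {C}`, is an expansion of a `C`-relation and is `C`-minimal:
in every structure elementarily equivalent to `U`, every subset definable with parameters is
definable, with parameters, without quantifiers in the language `{C}`. -/
def IsCMinimal (L : FirstOrder.Language.{a, b}) (U : Type v) [(L.sum cLang).Structure U] : Prop :=
  IsCRelation (@cRel U (cReduct L U)) ∧
  ∀ (U' : Type (max a b v)) [(L.sum cLang).Structure U'],
    (L.sum cLang).ElementarilyEquivalent U U' →
    ∀ S : Set U', (Set.univ : Set U').Definable₁ (L.sum cLang) S →
      @IsQFDefinableFromC U' (cReduct L U') S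

namespace ValuedModule

variable {K : Type u} [Field K] {φ : K →+* K} {M : Type v} [AddCommGroup M]
  [Module (SkewPoly φ)ᵐᵒᵖ M] {Δ : Type w} [LinearOrder Δ] [OrderTop Δ]

/-- `(M, v)` is trivially valued: `v` takes at most two values. -/
def IsTriviallyValued (V : ValuedModule φ M Δ) : Prop := (Set.range V.val).encard ≤ 2

/-- The canonical `C`-relation of the valuation. -/
def C (V : ValuedModule φ M Δ) (x y z : M) : Prop :=
  V.val (x - y) = V.val (x - z) ∧ V.val (x - z) < V.val (y - z)

/-- `(M, v)` as a structure in the language of right modules expanded by `C`. -/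
abbrev toStructure (V : ValuedModule φ M Δ) : ((moduleLang (SkewPoly φ)).sum cLang).Structure M :=
  letI : cLang.Structure M := cStructure V.C
  FirstOrder.Language.sumStructure (moduleLang (SkewPoly φ)) cLang M

/-- `(M, v)` is `C`-minimal. -/
def CMinimal (V : ValuedModule φ M Δ) : Prop :=
  letI := V.toStructure
  IsCMinimal (moduleLang (SkewPoly φ)) M

end ValuedModule

end

/-! Everything passes through one condition, `ZeroOrSurjectiveFiniteKernel`: each scalar acts on `M`
as zero, or surjectively with finite kernel. A trivial valuation makes `C(x,y,z)` mean `x ≠ y ∧ y =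
z`, so `C` is definable from equality, and the sets that are quantifier-free definable from `C` are
exactly the finite and cofinite ones. Thus `C`-minimality and strong minimality express the same
property.

Strong minimality gives the condition because the kernel and the image of a scalar are definable
subgroups, and a finite or cofinite subgroup of an infinite group is finite or everything.

Conversely, the condition is first-order, so it passes to elementarily equivalent modules, where it
yields quantifier elimination down to Boolean combinations of linear systems. Right ideals of
`K[t;φ]` are principal, so the `y`-part of a system is governed by a single scalar, and each fibre
is empty, everything, or a coset of a finite kernel. To handle Boolean combinations, indicators are
integrated along `y`: a function equal to `c` off a finite set has the pair of invariants (`c`,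
total deviation `s`), additive in the function. A nonnegative function vanishes iff both are zero,
so `∃ y` becomes the nonvanishing of two simple functions (`exists_hasChi_zeroSet`,
`IsSimpleSet.exists`). In one variable, an indicator with such a `c` is that of a finite or cofinite
set.

Finally, `zeroOrSurjectiveFiniteKernel_iff` splits the condition by whether a nonzero polynomial
kills `M`: if none does, this is case 1; otherwise the annihilator is completely prime, and a degree
argument makes the quotient a skew field, which is case 2. -/

open scoped Classical in
/-- `h` is equal to `c` outside of a finite set, over which the sum of `h - c` is `s`. -/
def HasChi {U : Type*} (h : U → ℚ) (c s : ℚ) : Prop :=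
  ∃ F : Finset U, (∀ y ∉ F, h y = c) ∧ ∑ y ∈ F, (h y - c) = s

/-! ### Integration of functions that are constant off a finite set. -/

namespace HasChi

variable {U : Type*}

open scoped Classical in
theorem sum_superset {h : U → ℚ} {c : ℚ} {F G : Finset U} (hF : ∀ y ∉ F, h y = c) (hFG : F ⊆ G) :
    ∑ y ∈ G, (h y - c) = ∑ y ∈ F, (h y - c) :=
  (Finset.sum_subset hFG fun y _ hy => by rw [hF y hy, sub_self]).symm

theorem const (c : ℚ) : HasChi (fun _ : U => c) c 0 := ⟨∅, by simp, by simp⟩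

open scoped Classical in
theorem add {h h' : U → ℚ} {c c' s s' : ℚ} (H : HasChi h c s) (H' : HasChi h' c' s') :
    HasChi (h + h') (c + c') (s + s') := by
  obtain ⟨F, hF, rfl⟩ := H
  obtain ⟨F', hF', rfl⟩ := H'
  refine ⟨F ∪ F', fun y hy => ?_, ?_⟩
  · rw [Finset.mem_union, not_or] at hy
    simp [hF y hy.1, hF' y hy.2]
  · rw [← sum_superset hF Finset.subset_union_left,
      ← sum_superset hF' Finset.subset_union_right, ← Finset.sum_add_distrib]
    exact Finset.sum_congr rfl fun y _ => by simp only [Pi.add_apply]; ring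

theorem smul {h : U → ℚ} {c s : ℚ} (q : ℚ) (H : HasChi h c s) :
    HasChi (q • h) (q * c) (q * s) := by
  obtain ⟨F, hF, rfl⟩ := H
  refine ⟨F, fun y hy => by simp [hF y hy], ?_⟩
  rw [Finset.mul_sum]
  exact Finset.sum_congr rfl fun y _ => by simp only [Pi.smul_apply, smul_eq_mul]; ring

open scoped Classical in
theorem indicator_finite {S : Set U} (hS : S.Finite) :
    HasChi (S.indicator 1) 0 S.ncard := by
  refine ⟨hS.toFinset, fun y hy => by simpa using hy, ?_⟩
  rw [Finset.sum_congr rfl (g := fun _ => (1 : ℚ)) fun y hy => by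
    simp [Set.indicator_of_mem ((hS.mem_toFinset).1 hy)]]
  simp [Set.ncard_eq_toFinset_card S hS]

/-- Infinity of `U` leaves a point outside the exceptional set, where `c` can be read off; over a
finite `U` any `c` would do. -/
theorem eq_zero [Infinite U] {c s : ℚ} (H : HasChi (0 : U → ℚ) c s) : c = 0 ∧ s = 0 := by
  obtain ⟨F, hF, rfl⟩ := H
  obtain ⟨y, hy⟩ := Infinite.exists_notMem_finset F
  have : c = 0 := (hF y hy).symm
  simp [this]

/-- With `c = 0` the invariant `s` is a sum of values of `h`, so no cancellation can occur. This
lets the two invariants detect whether a fibre is empty. -/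
theorem nonneg_eq_zero {h : U → ℚ} (h0 : 0 ≤ h) (H : HasChi h 0 0) : h = 0 := by
  obtain ⟨F, hF, hs⟩ := H
  ext y
  by_cases hy : y ∈ F
  · simp only [sub_zero] at hs
    exact (Finset.sum_eq_zero_iff_of_nonneg fun y _ => h0 y).1 hs y hy
  · exact hF y hy

theorem finite_or_cofinite {S : Set U} {c s : ℚ} (H : HasChi (S.indicator 1) c s) :
    S.Finite ∨ Sᶜ.Finite := by
  obtain ⟨F, hF, -⟩ := H
  by_cases hc : c = 0
  · left
    refine F.finite_toSet.subset fun y hy => ?_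
    by_contra hyF
    have := hF y hyF
    simp [Set.indicator_of_mem hy, hc] at this
  · right
    refine F.finite_toSet.subset fun y hy => ?_
    by_contra hyF
    exact hc ((hF y hyF).symm.trans (Set.indicator_of_notMem hy _))

end HasChi

/-- Every scalar acts on `U` as zero, or surjectively with a finite kernel. -/
def ZeroOrSurjectiveFiniteKernel (A : Type*) (U : Type*) [Ring A] [AddCommGroup U]
    [Module A U] : Prop :=
  ∀ a : A, (∀ y : U, a • y = 0) ∨ (∀ y : U, ∃ x : U, a • x = y) ∧ {x : U | a • x = 0}.Finite

/-! ### Linear systems, simple functions and elimination of one variable. -/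

section Eliminable

variable {A : Type*} {U : Type*} [Ring A] [AddCommGroup U] [Module A U] {X : Type*}

/-- The common zeros of the functions in `N`. -/
def zeroSet (N : Submodule A (X → U)) : Set X := {x | ∀ f ∈ N, f x = 0}

theorem zeroSet_sup (N N' : Submodule A (X → U)) :
    zeroSet (N ⊔ N') = zeroSet N ∩ zeroSet N' := by
  ext x
  refine ⟨fun h => ⟨fun f hf => h f (Submodule.mem_sup_left hf),
    fun f hf => h f (Submodule.mem_sup_right hf)⟩, fun h f hf => ?_⟩
  obtain ⟨g, hg, g', hg', rfl⟩ := Submodule.mem_sup.1 hf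
  simp [h.1 g hg, h.2 g' hg']

/-- The span of the indicators of the zero sets of systems of equations from `T`. -/
def simpleFunctions (T : Submodule A (X → U)) : Submodule ℚ (X → ℚ) :=
  Submodule.span ℚ {F | ∃ N ≤ T, F = (zeroSet N).indicator 1}

theorem indicator_zeroSet_mem {T N : Submodule A (X → U)} (h : N ≤ T) :
    (zeroSet N).indicator 1 ∈ simpleFunctions T :=
  Submodule.subset_span ⟨N, h, rfl⟩

theorem one_mem_simpleFunctions (T : Submodule A (X → U)) : 1 ∈ simpleFunctions T := by
  have : (zeroSet (⊥ : Submodule A (X → U))) = Set.univ := by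
    ext x; simp [zeroSet]
  simpa [this] using indicator_zeroSet_mem (bot_le : ⊥ ≤ T)

/-- The intersection of two solution sets is the solution set of the joint system, so products of
generators are generators. -/
theorem mul_mem_simpleFunctions {T : Submodule A (X → U)} {F G : X → ℚ}
    (hF : F ∈ simpleFunctions T) (hG : G ∈ simpleFunctions T) : F * G ∈ simpleFunctions T := by
  induction hF using Submodule.span_induction with
  | zero => simp
  | add F F' _ _ h h' => rw [add_mul]; exact add_mem h h'
  | smul q F _ h => rw [smul_mul_assoc]; exact Submodule.smul_mem _ _ h
  | mem F hF =>
    obtain ⟨N, hN, rfl⟩ := hF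
    induction hG using Submodule.span_induction with
    | zero => simp
    | add F F' _ _ h h' => rw [mul_add]; exact add_mem h h'
    | smul q F _ h => rw [mul_smul_comm]; exact Submodule.smul_mem _ _ h
    | mem G hG =>
      obtain ⟨N', hN', rfl⟩ := hG
      rw [← Set.inter_indicator_one, ← zeroSet_sup]
      exact indicator_zeroSet_mem (sup_le hN hN')

theorem prod_mem_simpleFunctions {T : Submodule A (X → U)} {ι : Type*} (s : Finset ι)
    {F : ι → X → ℚ} (h : ∀ i ∈ s, F i ∈ simpleFunctions T) :
    ∏ i ∈ s, F i ∈ simpleFunctions T :=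
  Finset.prod_induction _ (· ∈ simpleFunctions T) (fun _ _ => mul_mem_simpleFunctions)
    (one_mem_simpleFunctions T) h

theorem finite_range_of_mem_simpleFunctions {T : Submodule A (X → U)} {F : X → ℚ}
    (hF : F ∈ simpleFunctions T) : (Set.range F).Finite := by
  induction hF using Submodule.span_induction with
  | zero => exact (Set.finite_singleton 0).subset (by rintro _ ⟨x, rfl⟩; simp)
  | add F F' _ _ h h' =>
    exact (Set.Finite.image2 (· + ·) h h').subset
      (by rintro _ ⟨x, rfl⟩; exact ⟨F x, ⟨x, rfl⟩, F' x, ⟨x, rfl⟩, rfl⟩)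
  | smul q F _ h =>
    exact (h.image (q • ·)).subset (by rintro _ ⟨x, rfl⟩; exact ⟨F x, ⟨x, rfl⟩, rfl⟩)
  | mem F hF =>
    obtain ⟨N, -, rfl⟩ := hF
    exact (Set.toFinite {0, 1}).subset (by
      rintro _ ⟨x, rfl⟩
      rcases Set.indicator_eq_zero_or_self (zeroSet N) (1 : X → ℚ) x with h | h <;> simp [h])

/-- `S` is a Boolean combination of the zero sets of systems of equations from `T`. -/
def IsSimpleSet (T : Submodule A (X → U)) (S : Set X) : Prop :=
  S.indicator 1 ∈ simpleFunctions T

namespace IsSimpleSet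

variable {T : Submodule A (X → U)} {S S' : Set X}

theorem compl (h : IsSimpleSet T S) : IsSimpleSet T Sᶜ := by
  unfold IsSimpleSet
  rw [Set.indicator_compl]
  exact sub_mem (one_mem_simpleFunctions T) h

theorem inter (h : IsSimpleSet T S) (h' : IsSimpleSet T S') : IsSimpleSet T (S ∩ S') := by
  unfold IsSimpleSet
  rw [Set.inter_indicator_one]
  exact mul_mem_simpleFunctions h h'

theorem union (h : IsSimpleSet T S) (h' : IsSimpleSet T S') : IsSimpleSet T (S ∪ S') := by
  simpa [Set.compl_inter] using (h.compl.inter h'.compl).compl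

theorem of_eq_zero {f : X → U} (hf : f ∈ T) : IsSimpleSet T {x | f x = 0} := by
  have : {x | f x = 0} = zeroSet (Submodule.span A {f}) := by
    ext x
    refine ⟨fun h g hg => ?_, fun h => h f (Submodule.mem_span_singleton_self f)⟩
    obtain ⟨a, rfl⟩ := Submodule.mem_span_singleton.1 hg
    simp only [Set.mem_ofPred_eq] at h
    simp [h]
  rw [this]
  exact indicator_zeroSet_mem ((Submodule.span_singleton_le_iff_mem _ _).2 hf)

theorem ne_zero {F : X → ℚ} (hF : F ∈ simpleFunctions T) : IsSimpleSet T {x | F x ≠ 0} := by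
  have hfin := finite_range_of_mem_simpleFunctions hF
  classical
  let s := hfin.toFinset.erase 0
  -- `F` takes finitely many values; this polynomial in `F` is `1` where `F` vanishes and `0` at
  -- every nonzero value.
  have hmem : ∏ c ∈ s, (1 - c⁻¹ • F) ∈ simpleFunctions T :=
    prod_mem_simpleFunctions s fun c _ =>
      sub_mem (one_mem_simpleFunctions T) (Submodule.smul_mem _ _ hF)
  have : {x | F x ≠ 0}ᶜ.indicator 1 = ∏ c ∈ s, (1 - c⁻¹ • F) := by
    ext x
    rw [Finset.prod_apply]
    by_cases hx : F x = 0
    · simp [hx]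
    · rw [Set.indicator_of_notMem (by simpa using hx), eq_comm]
      exact Finset.prod_eq_zero (i := F x) (by simp [s, hx]) (by simp [hx])
  have h' : IsSimpleSet T {x | F x ≠ 0}ᶜ := by
    unfold IsSimpleSet
    rwa [this]
  simpa using h'.compl

end IsSimpleSet

variable {X' : Type*}

/-- The fibre of a system of equations is empty, everything, or a coset of a finite kernel. -/
theorem exists_hasChi_zeroSet [IsPrincipalIdealRing A] (hU : ZeroOrSurjectiveFiniteKernel A U)
    {T : Submodule A (X → U)} {T' : Submodule A (X' → U)} {e : X → U → X'}
    (he : ∀ h ∈ T', ∃ f ∈ T, ∃ a : A, ∀ x y, h (e x y) = f x + a • y)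
    {N' : Submodule A (X' → U)} (hN' : N' ≤ T') :
    ∃ N ≤ T, ∃ c s : ℚ, ∀ x,
      (x ∈ zeroSet N → HasChi (fun y => (zeroSet N').indicator 1 (e x y)) c s) ∧
      (x ∉ zeroSet N → ∀ y, e x y ∉ zeroSet N') := by
  -- The equations of the system, rewritten as `f x + a • y = 0` and recorded as pairs `(f, a)`.
  let P : Submodule A ((X → U) × A) :=
    { carrier := {p | p.1 ∈ T ∧ ∃ h ∈ N', ∀ x y, h (e x y) = p.1 x + p.2 • y}
      zero_mem' := ⟨T.zero_mem, 0, N'.zero_mem, by simp⟩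
      add_mem' := by
        rintro p q ⟨hp, h, hh, hph⟩ ⟨hq, h', hh', hqh⟩
        exact ⟨T.add_mem hp hq, h + h', N'.add_mem hh hh', fun x y => by
          simp [hph, hqh, add_smul]; abel⟩
      smul_mem' := by
        rintro b p ⟨hp, h, hh, hph⟩
        exact ⟨T.smul_mem b hp, b • h, N'.smul_mem b hh, fun x y => by
          simp [hph, mul_smul]⟩ }
  -- The conditions on `x` alone. Requiring that `a` act as zero, rather than `a = 0`, covers
  -- modules that are not faithful.
  let N : Submodule A (X → U) :=
    { carrier := {f | ∃ a : A, (f, a) ∈ P ∧ ∀ y : U, a • y = 0}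
      zero_mem' := ⟨0, P.zero_mem, by simp⟩
      add_mem' := by
        rintro f g ⟨a, ha, ha0⟩ ⟨b, hb, hb0⟩
        exact ⟨a + b, P.add_mem ha hb, fun y => by simp [add_smul, ha0, hb0]⟩
      smul_mem' := by
        rintro b f ⟨a, ha, ha0⟩
        exact ⟨b * a, P.smul_mem b ha, fun y => by simp [mul_smul, ha0]⟩ }
  have hmem : ∀ x y, e x y ∈ zeroSet N' ↔ ∀ p ∈ P, p.1 x + p.2 • y = 0 := by
    refine fun x y => ⟨fun h p hp => ?_, fun h f hf => ?_⟩
    · obtain ⟨-, g, hg, hgp⟩ := hp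
      rw [← hgp]
      exact h g hg
    · obtain ⟨g, hg, a, hga⟩ := he f (hN' hf)
      rw [hga]
      exact h (g, a) ⟨hg, f, hf, hga⟩
  have hnot : ∀ x, x ∉ zeroSet N → ∀ y, e x y ∉ zeroSet N' := by
    intro x hx y hy
    apply hx
    rintro f ⟨a, ha, ha0⟩
    simpa [ha0] using (hmem x y).1 hy _ ha
  have hNT : N ≤ T := fun f ⟨a, ha, _⟩ => ha.1
  -- The coefficients of `y` form a left ideal, so a single equation `f₀ x + g • y = 0` controls the
  -- dependence on `y`.
  obtain ⟨g, hg⟩ := IsPrincipalIdealRing.principal (P.map (LinearMap.snd A (X → U) A))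
  have hgmem : g ∈ P.map (LinearMap.snd A (X → U) A) := by
    rw [hg]; exact Submodule.mem_span_singleton_self g
  obtain ⟨⟨f₀, g'⟩, hf₀, hg'⟩ := hgmem
  obtain rfl : g' = g := hg'
  have hdiv : ∀ p ∈ P, ∃ b : A, p.2 = b * g' := by
    intro p hp
    have : p.2 ∈ P.map (LinearMap.snd A (X → U) A) := ⟨p, hp, rfl⟩
    rw [hg] at this
    obtain ⟨b, hb⟩ := Submodule.mem_span_singleton.1 this
    exact ⟨b, hb.symm⟩
  -- If `g'` acts as zero, so do all coefficients, and a fibre over `zeroSet N` is everything.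
  -- Otherwise it is a coset of the finite kernel of `g'`, whence `c = 0` and `s` is the order of
  -- that kernel.
  rcases hU g' with h0 | ⟨hsurj, hfin⟩
  · refine ⟨N, hNT, 1, 0, fun x => ⟨fun hx => ?_, hnot x⟩⟩
    convert HasChi.const (U := U) 1 using 2 with y
    rw [Set.indicator_of_mem]
    · rfl
    rw [hmem]
    intro p hp
    obtain ⟨b, hb⟩ := hdiv p hp
    have hp0 : ∀ y : U, p.2 • y = 0 := fun y => by rw [hb, mul_smul, h0, smul_zero]
    rw [hp0, add_zero]
    exact hx p.1 ⟨p.2, hp, hp0⟩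
  · refine ⟨N, hNT, 0, {x : U | g' • x = 0}.ncard, fun x => ⟨fun hx => ?_, hnot x⟩⟩
    obtain ⟨y₀, hy₀⟩ := hsurj (-f₀ x)
    have hfib : ∀ y, e x y ∈ zeroSet N' ↔ g' • (y - y₀) = 0 := by
      intro y
      have key : g' • (y - y₀) = f₀ x + g' • y := by rw [smul_sub, hy₀]; abel
      rw [hmem, key]
      refine ⟨fun h => h _ hf₀, fun h p hp => ?_⟩
      obtain ⟨b, hb⟩ := hdiv p hp
      -- Subtracting `b` times the controlling equation kills the coefficient of `y`; what remains
      -- already holds on `zeroSet N`.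
      have h1 : p.1 - b • f₀ ∈ N :=
        ⟨0, by
          have h1 := P.sub_mem hp (P.smul_mem b hf₀)
          have h2 : p - b • (f₀, g') = (p.1 - b • f₀, 0) := by ext <;> simp [hb]
          rwa [h2] at h1, by simp⟩
      have h2 := hx _ h1
      simp only [Pi.sub_apply, Pi.smul_apply, sub_eq_zero] at h2
      rw [h2, hb, mul_smul, ← smul_add, h, smul_zero]
    have himg : {y | g' • (y - y₀) = 0} = (· + y₀) '' {x : U | g' • x = 0} := by
      ext y
      simp [sub_eq_add_neg]
    have := HasChi.indicator_finite (S := {y | g' • (y - y₀) = 0}) (himg ▸ hfin.image _)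
    rw [himg, Set.ncard_image_of_injective _ (add_left_injective y₀), ← himg] at this
    convert this using 2 with y
    by_cases hy : g' • (y - y₀) = 0
    · rw [Set.indicator_of_mem ((hfib y).2 hy), Set.indicator_of_mem (by exact hy)]; rfl
    · rw [Set.indicator_of_notMem (mt (hfib y).1 hy), Set.indicator_of_notMem (by exact hy)]

/-- Both invariants are linear in the integrand, so only indicators of solution sets matter. There
they do not depend on `x` within `zeroSet N` and may be taken zero elsewhere. -/
theorem exists_hasChi [IsPrincipalIdealRing A] (hU : ZeroOrSurjectiveFiniteKernel A U)
    {T : Submodule A (X → U)} {T' : Submodule A (X' → U)} {e : X → U → X'}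
    (he : ∀ h ∈ T', ∃ f ∈ T, ∃ a : A, ∀ x y, h (e x y) = f x + a • y)
    {F : X' → ℚ} (hF : F ∈ simpleFunctions T') :
    ∃ G ∈ simpleFunctions T, ∃ H ∈ simpleFunctions T,
      ∀ x, HasChi (fun y => F (e x y)) (G x) (H x) := by
  induction hF using Submodule.span_induction with
  | zero => exact ⟨0, zero_mem _, 0, zero_mem _, fun x => HasChi.const 0⟩
  | add F F' _ _ h h' =>
    obtain ⟨G, hG, H, hH, hh⟩ := h
    obtain ⟨G', hG', H', hH', hh'⟩ := h'
    exact ⟨G + G', add_mem hG hG', H + H', add_mem hH hH', fun x => (hh x).add (hh' x)⟩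
  | smul q F _ h =>
    obtain ⟨G, hG, H, hH, hh⟩ := h
    exact ⟨q • G, Submodule.smul_mem _ _ hG, q • H, Submodule.smul_mem _ _ hH,
      fun x => (hh x).smul q⟩
  | mem F hF =>
    obtain ⟨N', hN', rfl⟩ := hF
    obtain ⟨N, hN, c, s, h⟩ := exists_hasChi_zeroSet hU he hN'
    refine ⟨c • (zeroSet N).indicator 1, Submodule.smul_mem _ _ (indicator_zeroSet_mem hN),
      s • (zeroSet N).indicator 1, Submodule.smul_mem _ _ (indicator_zeroSet_mem hN), fun x => ?_⟩
    by_cases hx : x ∈ zeroSet N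
    · simpa [hx] using (h x).1 hx
    · have := (h x).2 hx
      simpa [hx, this] using HasChi.const (U := U) 0

/-- The fibre over `x` is nonempty iff the integral of its indicator has a nonzero invariant, and
the locus where a simple function is nonzero is simple. -/
theorem IsSimpleSet.exists [IsPrincipalIdealRing A] [Infinite U]
    (hU : ZeroOrSurjectiveFiniteKernel A U)
    {T : Submodule A (X → U)} {T' : Submodule A (X' → U)} {e : X → U → X'}
    (he : ∀ h ∈ T', ∃ f ∈ T, ∃ a : A, ∀ x y, h (e x y) = f x + a • y)
    {S : Set X'} (hS : IsSimpleSet T' S) : IsSimpleSet T {x | ∃ y, e x y ∈ S} := by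
  obtain ⟨G, hG, H, hH, h⟩ := exists_hasChi hU he hS
  have : {x | ∃ y, e x y ∈ S} = {x | G x ≠ 0} ∪ {x | H x ≠ 0} := by
    ext x
    simp only [Set.mem_union, Set.mem_ofPred_eq]
    constructor
    · rintro ⟨y, hy⟩
      by_contra! hx
      have := h x
      rw [hx.1, hx.2] at this
      have := congrFun (HasChi.nonneg_eq_zero (fun y => Set.indicator_nonneg (by simp) _) this) y
      simp [hy] at this
    · intro hx
      by_contra! hy
      have h0 : (fun y => S.indicator (1 : X' → ℚ) (e x y)) = 0 := by
        ext y; simp [hy y]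
      have := h x
      rw [h0] at this
      have := this.eq_zero
      tauto
  rw [this]
  exact (IsSimpleSet.ne_zero hG).union (IsSimpleSet.ne_zero hH)

theorem IsSimpleSet.finite_or_cofinite [IsPrincipalIdealRing A]
    (hU : ZeroOrSurjectiveFiniteKernel A U) {T' : Submodule A (X' → U)} {e : U → X'}
    (he : ∀ h ∈ T', ∃ u : U, ∃ a : A, ∀ y, h (e y) = u + a • y)
    {S : Set X'} (hS : IsSimpleSet T' S) : (e ⁻¹' S).Finite ∨ (e ⁻¹' S)ᶜ.Finite := by
  -- Over a one-point base the constants `u` become functions, and the whole set is a single fibre.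
  obtain ⟨G, -, H, -, h⟩ := exists_hasChi (X := Unit) (T := ⊤) (e := fun _ => e) hU
    (fun h hh => by
      obtain ⟨u, a, hu⟩ := he h hh
      exact ⟨fun _ => u, trivial, a, fun _ => hu⟩) hS
  exact HasChi.finite_or_cofinite (h ())

end Eliminable

noncomputable section

/-! ### Degree and division with remainder for skew polynomials. -/

namespace SkewPolynomial

variable {D : Type*} [DivisionRing D]

/-- The degree of a skew polynomial, `0` for the zero polynomial. -/
def natDegree (p : SkewPolynomial D) : ℕ := p.support.sup id

theorem coeff_eq_zero_of_natDegree_lt {p : SkewPolynomial D} {n : ℕ} (h : natDegree p < n) :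
    p.coeff n = 0 := by
  by_contra hn
  exact absurd (Finset.le_sup (f := id) (mem_support_iff.2 hn)) (not_le.2 h)

theorem coeff_natDegree_ne_zero {p : SkewPolynomial D} (hp : p ≠ 0) :
    p.coeff (natDegree p) ≠ 0 := by
  have hne : p.support.Nonempty := by
    rw [Finset.nonempty_iff_ne_empty]
    simpa using hp
  obtain ⟨i, hi, h⟩ := Finset.exists_mem_eq_sup p.support hne id
  rw [natDegree, h]
  exact mem_support_iff.1 hi

theorem natDegree_eq {p : SkewPolynomial D} {n : ℕ} (h : p.coeff n ≠ 0)
    (h' : ∀ i, n < i → p.coeff i = 0) : natDegree p = n := by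
  have hp : p ≠ 0 := by rintro rfl; simp at h
  refine le_antisymm ?_ ?_
  · by_contra! hlt
    exact coeff_natDegree_ne_zero hp (h' _ hlt)
  · by_contra! hlt
    exact h (coeff_eq_zero_of_natDegree_lt hlt)

variable [MulSemiringAction (Multiplicative ℕ) D]

theorem coeff_monomial_mul (k n : ℕ) (c : D) (q : SkewPolynomial D) :
    coeff (monomial k c * q) (k + n) = c * ((Multiplicative.ofAdd k) • q.coeff n) :=
  SkewMonoidAlgebra.coeff_single_mul_aux q fun a => by
    rw [ofAdd_add]
    exact mul_right_inj _

/-- Endomorphisms of a division ring are injective. This is all that additivity of degrees and the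
division algorithm need; surjectivity of the twist plays no role. -/
theorem smul_ne_zero_of_ne_zero (g : Multiplicative ℕ) {a : D} (ha : a ≠ 0) : g • a ≠ 0 :=
  (map_ne_zero (MulSemiringAction.toRingHom (Multiplicative ℕ) D g)).2 ha

theorem coeff_mul (p q : SkewPolynomial D) (n : ℕ) :
    coeff (p * q) n = ∑ i ∈ p.support, coeff (monomial i (p.coeff i) * q) n := by
  conv_lhs => rw [← sum_monomial p, sum_def, Finset.sum_mul]
  exact map_sum (⟨⟨fun r => coeff r n, rfl⟩, fun _ _ => coeff_add _ _ _⟩ :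
    SkewPolynomial D →+ D) _ _

theorem coeff_mul_natDegree (p q : SkewPolynomial D) :
    coeff (p * q) (natDegree p + natDegree q) = p.coeff (natDegree p) *
      ((Multiplicative.ofAdd (natDegree p)) • q.coeff (natDegree q)) := by
  rw [coeff_mul, Finset.sum_eq_single (natDegree p), coeff_monomial_mul]
  · intro i hi hne
    have hle : i ≤ natDegree p := Finset.le_sup (f := id) hi
    obtain ⟨j, hj⟩ : ∃ j, natDegree p + natDegree q = i + j := ⟨natDegree p + natDegree q - i, by omega⟩
    rw [hj, coeff_monomial_mul, coeff_eq_zero_of_natDegree_lt (p := q) (by omega), smul_zero, mul_zero]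
  · intro h
    rw [notMem_support_iff.1 h]
    simp

theorem coeff_mul_of_lt {p q : SkewPolynomial D} {n : ℕ} (h : natDegree p + natDegree q < n) :
    coeff (p * q) n = 0 := by
  rw [coeff_mul]
  refine Finset.sum_eq_zero fun i hi => ?_
  have hle : i ≤ natDegree p := Finset.le_sup (f := id) hi
  obtain ⟨j, rfl⟩ : ∃ j, n = i + j := ⟨n - i, by omega⟩
  rw [coeff_monomial_mul, coeff_eq_zero_of_natDegree_lt (p := q) (by omega), smul_zero, mul_zero]

theorem coeff_mul_natDegree_ne_zero {p q : SkewPolynomial D} (hp : p ≠ 0) (hq : q ≠ 0) :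
    coeff (p * q) (natDegree p + natDegree q) ≠ 0 := by
  rw [coeff_mul_natDegree]
  exact mul_ne_zero (coeff_natDegree_ne_zero hp)
    (smul_ne_zero_of_ne_zero _ (coeff_natDegree_ne_zero hq))

instance : NoZeroDivisors (SkewPolynomial D) where
  eq_zero_or_eq_zero_of_mul_eq_zero {p q} h := by
    by_contra! hpq
    exact coeff_mul_natDegree_ne_zero hpq.1 hpq.2 (by simp [h])

theorem natDegree_mul {p q : SkewPolynomial D} (hp : p ≠ 0) (hq : q ≠ 0) :
    natDegree (p * q) = natDegree p + natDegree q :=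
  natDegree_eq (coeff_mul_natDegree_ne_zero hp hq) fun _ => coeff_mul_of_lt

theorem isUnit_of_natDegree_eq_zero {p : SkewPolynomial D} (hp : p ≠ 0) (h : natDegree p = 0) :
    IsUnit p := by
  have h0 := coeff_natDegree_ne_zero hp
  rw [h] at h0
  have : p = CRingHom (p.coeff 0) := by
    ext n
    rw [CRingHom_eq_C, coeff_C]
    split_ifs with hn
    · rw [hn]
    · exact coeff_eq_zero_of_natDegree_lt (by omega)
  rw [this]
  exact (isUnit_iff_ne_zero.2 h0).map _

theorem mem_span_of_minimal {I : Ideal (SkewPolynomial D)} {g : SkewPolynomial D} (hg : g ∈ I)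
    (hg0 : g ≠ 0) (hmin : ∀ f ∈ I, f ≠ 0 → natDegree g ≤ natDegree f) (n : ℕ) :
    ∀ f ∈ I, (∀ i, n ≤ i → f.coeff i = 0) → f ∈ Ideal.span {g} := by
  induction n with
  | zero =>
    intro f _ hf
    have : f = 0 := by ext i; simp [hf i (Nat.zero_le i)]
    simp [this]
  | succ n ih =>
    intro f hfI hf
    by_cases hn : f.coeff n = 0
    · refine ih f hfI fun i hi => ?_
      rcases hi.eq_or_lt with rfl | hi
      · exact hn
      · exact hf i hi
    have hdeg : natDegree f = n := natDegree_eq hn fun i hi => hf i hi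
    have hle : natDegree g ≤ n := hdeg ▸ hmin f hfI (by rintro rfl; simp at hn)
    set m := natDegree g with hm
    have hlead : (Multiplicative.ofAdd (n - m)) • g.coeff m ≠ 0 :=
      smul_ne_zero_of_ne_zero _ (coeff_natDegree_ne_zero hg0)
    -- Multiplying `g` on the left twists its leading coefficient, so the coefficient of `q` inverts
    -- the twisted one and `f - q * g` loses degree `n`.
    set q := monomial (n - m) (f.coeff n * ((Multiplicative.ofAdd (n - m)) • g.coeff m)⁻¹)
      with hq
    have hqg : q * g ∈ Ideal.span {g} :=
      Ideal.mul_mem_left _ _ (Ideal.mem_span_singleton_self g)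
    have hsub : f - q * g ∈ Ideal.span {g} := by
      refine ih _ (I.sub_mem hfI (I.mul_mem_left _ hg)) fun i hi => ?_
      obtain ⟨j, rfl⟩ : ∃ j, i = (n - m) + j := ⟨i - (n - m), by omega⟩
      rw [coeff_sub, hq, coeff_monomial_mul]
      rcases hi.eq_or_lt with h | h
      · obtain rfl : j = m := by omega
        rw [← h, mul_assoc, inv_mul_cancel₀ hlead, mul_one, sub_self]
      · rw [hf _ h, coeff_eq_zero_of_natDegree_lt (p := g) (n := j) (by omega), smul_zero, mul_zero,
          sub_zero]
    simpa using add_mem hsub hqg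

instance : IsPrincipalIdealRing (SkewPolynomial D) where
  principal I := by
    by_cases hI : I = ⊥
    · exact ⟨0, by simp [hI]⟩
    obtain ⟨p, hp, hp0⟩ := Submodule.exists_mem_ne_zero_of_ne_bot hI
    obtain ⟨g, ⟨hg, hg0⟩, hmin⟩ := exists_minimalFor_of_wellFoundedLT
      (fun f => f ∈ I ∧ f ≠ 0) natDegree ⟨p, hp, hp0⟩
    refine ⟨g, le_antisymm (fun f hf => ?_) ((Ideal.span_singleton_le_iff_mem I).2 hg)⟩
    exact mem_span_of_minimal hg hg0
      (fun f hf hf0 => (le_total _ _).elim id fun h => hmin ⟨hf, hf0⟩ h) (natDegree f + 1) f hf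
      fun i hi => coeff_eq_zero_of_natDegree_lt (by omega)

end SkewPolynomial

section SkewPoly

variable {K : Type u} [Field K] {φ : K →+* K}

/-- Left ideals here correspond to right ideals of `K[t;φ]`, the side on which division works for
every `φ`. -/
instance : IsPrincipalIdealRing (SkewPoly φ)ᵐᵒᵖ :=
  IsPrincipalIdealRing.of_surjective (RingEquiv.opOp (SkewPolynomial (TwistedField φ)))
    (RingEquiv.surjective _)

namespace SkewPoly

/-- If `r ≠ 0` and `r = g r u`, then `g` has degree `0`. -/
theorem isUnit_of_eq_mul_mul {r g u : SkewPoly φ} (hr : r ≠ 0) (h : r = g * r * u) :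
    IsUnit g := by
  have hg : g ≠ 0 := by rintro rfl; simp at h; exact hr h
  have hu : u ≠ 0 := by rintro rfl; simp at h; exact hr h
  have hr' : unop r ≠ 0 := by simpa using hr
  have hg' : unop g ≠ 0 := by simpa using hg
  have hu' : unop u ≠ 0 := by simpa using hu
  have hd := congrArg (fun p => SkewPolynomial.natDegree (unop p)) h
  simp only [unop_mul] at hd
  rw [SkewPolynomial.natDegree_mul hu' (mul_ne_zero hr' hg'),
    SkewPolynomial.natDegree_mul hr' hg'] at hd
  exact (SkewPolynomial.isUnit_of_natDegree_eq_zero hg' (by omega)).op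

theorem isUnit_of_eq_mul_mul' {r g u : SkewPoly φ} (hr : r ≠ 0) (h : r = r * u * g) :
    IsUnit g := by
  have hg : g ≠ 0 := by rintro rfl; simp at h; exact hr h
  have hu : u ≠ 0 := by rintro rfl; simp at h; exact hr h
  have hr' : unop r ≠ 0 := by simpa using hr
  have hg' : unop g ≠ 0 := by simpa using hg
  have hu' : unop u ≠ 0 := by simpa using hu
  have hd := congrArg (fun p => SkewPolynomial.natDegree (unop p)) h
  simp only [unop_mul] at hd
  rw [SkewPolynomial.natDegree_mul hg' (mul_ne_zero hu' hr'),
    SkewPolynomial.natDegree_mul hu' hr'] at hd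
  exact (SkewPolynomial.isUnit_of_natDegree_eq_zero hg' (by omega)).op

/-- Right ideals of `K[t;φ]` are principal. -/
theorem exists_eq_mul (I : Submodule (SkewPoly φ)ᵐᵒᵖ (SkewPoly φ)) :
    ∃ g : SkewPoly φ, ∀ q, q ∈ I ↔ ∃ s, q = g * s := by
  let e : (SkewPoly φ) ≃ₗ[(SkewPoly φ)ᵐᵒᵖ] (SkewPoly φ)ᵐᵒᵖ :=
    { MulOpposite.opAddEquiv with
      map_smul' := fun _ _ => rfl }
  obtain ⟨g, hg⟩ := IsPrincipalIdealRing.principal (I.map e.toLinearMap)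
  refine ⟨unop g, fun q => ?_⟩
  have : q ∈ I ↔ op q ∈ I.map e.toLinearMap :=
    ⟨fun h => ⟨q, h, rfl⟩, fun ⟨q', h, hq⟩ => by rwa [← op_injective hq]⟩
  rw [this, hg, Submodule.mem_span_singleton]
  constructor
  · rintro ⟨a, ha⟩
    exact ⟨unop a, by rw [← unop_op q, ← ha]; rfl⟩
  · rintro ⟨s, rfl⟩
    exact ⟨op s, rfl⟩

end SkewPoly

end SkewPoly

/-! ### The dichotomy for scalars and the two algebraic conditions. -/

section Action

variable {K : Type u} [Field K] {φ : K →+* K} {M : Type v} [AddCommGroup M]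
  [Module (SkewPoly φ)ᵐᵒᵖ M]

theorem ringCon_mk'_eq_iff {R : Type u} [Ring R] {M : Type v} [AddCommGroup M] [Module Rᵐᵒᵖ M]
    (p q : R) : (annihilatorIdeal R M).ringCon.mk' p = (annihilatorIdeal R M).ringCon.mk' q ↔
      ∀ x : M, op p • x = op q • x := by
  have h1 : (annihilatorIdeal R M).ringCon.mk' p = (annihilatorIdeal R M).ringCon.mk' q ↔
      (annihilatorIdeal R M).ringCon p q := RingCon.eq _
  rw [h1, TwoSidedIdeal.rel_iff, mem_annihilatorIdeal]
  simp [sub_smul, sub_eq_zero]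

/-- `M` is a module over the quotient of `R` by its annihilator. -/
@[reducible]
def moduleQuotientAnnihilator (R : Type u) [Ring R] (M : Type v) [AddCommGroup M]
    [Module Rᵐᵒᵖ M] : Module ((annihilatorIdeal R M).ringCon.Quotient)ᵐᵒᵖ M :=
  let f : R → AddMonoid.End M := fun q => DistribSMul.toAddMonoidHom M (op q)
  let F : (annihilatorIdeal R M).ringCon.Quotient → AddMonoid.End M :=
    Quotient.lift f fun p q h => by
      ext x
      exact (ringCon_mk'_eq_iff p q).1 (Quotient.sound h) x
  { smul := fun a x => F (unop a) x
    one_smul := fun x => one_smul Rᵐᵒᵖ x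
    mul_smul := fun a b x => by
      obtain ⟨a, rfl⟩ := op_surjective a
      obtain ⟨b, rfl⟩ := op_surjective b
      obtain ⟨a, rfl⟩ := RingCon.mk'_surjective _ a
      obtain ⟨b, rfl⟩ := RingCon.mk'_surjective _ b
      exact mul_smul (op a) (op b) x
    smul_zero := fun a => map_zero (F (unop a))
    smul_add := fun a => map_add (F (unop a))
    add_smul := fun a b x => by
      obtain ⟨a, rfl⟩ := op_surjective a
      obtain ⟨b, rfl⟩ := op_surjective b
      obtain ⟨a, rfl⟩ := RingCon.mk'_surjective _ a
      obtain ⟨b, rfl⟩ := RingCon.mk'_surjective _ b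
      exact add_smul (op a) (op b) x
    zero_smul := fun x => zero_smul Rᵐᵒᵖ x }

theorem zeroOrSurjectiveFiniteKernel_of_isVectorSpace {R : Type u} [Ring R] {M : Type v}
    [AddCommGroup M] [Module Rᵐᵒᵖ M] (h : IsVectorSpaceModuloIrreducible R M) :
    ZeroOrSurjectiveFiniteKernel Rᵐᵒᵖ M := by
  obtain ⟨r, -, -, ⟨-, hfield⟩, -⟩ := h
  intro a
  by_cases ha : ∀ y : M, a • y = 0
  · exact Or.inl ha
  right
  have hne : (annihilatorIdeal R M).ringCon.mk' (unop a) ≠ 0 := by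
    rw [← map_zero ((annihilatorIdeal R M).ringCon.mk'), Ne, ringCon_mk'_eq_iff]
    simpa using ha
  -- An inverse modulo the annihilator acts as a genuine inverse on `M`, so the kernel is even
  -- trivial.
  obtain ⟨b, hb, hb'⟩ := isUnit_iff_exists.1 (hfield _ hne)
  obtain ⟨b, rfl⟩ := RingCon.mk'_surjective _ b
  rw [← map_mul, ← map_one ((annihilatorIdeal R M).ringCon.mk'), ringCon_mk'_eq_iff] at hb hb'
  simp only [op_mul, op_unop, op_one, one_smul, mul_smul] at hb hb'
  refine ⟨fun y => ⟨op b • y, hb' y⟩, (Set.finite_singleton (0 : M)).subset fun x hx => ?_⟩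
  have hx' : a • x = 0 := hx
  rw [Set.mem_singleton_iff, ← hb x, hx', smul_zero]

theorem zeroOrSurjectiveFiniteKernel_of_isDivisible {R : Type u} [Ring R] {M : Type v}
    [AddCommGroup M] [Module Rᵐᵒᵖ M] (h : IsDivisibleModule R M)
    (h' : ∀ r : R, r ≠ 0 → (ann M r).Finite) : ZeroOrSurjectiveFiniteKernel Rᵐᵒᵖ M := by
  intro a
  by_cases ha : a = 0
  · exact Or.inl (by simp [ha])
  · have ha' : unop a ≠ 0 := by simpa using ha
    exact Or.inr ⟨h _ ha', h' _ ha'⟩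

/-- A scalar outside the annihilator `I` is surjective, which makes `I` completely prime. Since
right ideals are principal and degrees add, factorizations of the generator `r` are trivial, and
every element outside `I` is invertible modulo `I`. -/
theorem isVectorSpaceModuloIrreducible [Nontrivial M]
    (h : ZeroOrSurjectiveFiniteKernel (SkewPoly φ)ᵐᵒᵖ M)
    (h0 : ∃ q : SkewPoly φ, q ≠ 0 ∧ ∀ x : M, op q • x = 0) :
    IsVectorSpaceModuloIrreducible (SkewPoly φ) M := by
  let I : Submodule (SkewPoly φ)ᵐᵒᵖ (SkewPoly φ) :=
    { carrier := {q | ∀ x : M, op q • x = 0}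
      zero_mem' := by simp
      add_mem' := fun {p q} hp hq x => by simp [add_smul, hp x, hq x]
      smul_mem' := fun a {q} hq x => by
        rw [show op (a • q) = a * op q from rfl, mul_smul, hq x, smul_zero] }
  have hmem : ∀ q, q ∈ I ↔ ∀ x : M, op q • x = 0 := fun q => Iff.rfl
  obtain ⟨r, hr⟩ := SkewPoly.exists_eq_mul I
  have hrI : r ∈ I := (hr r).2 ⟨1, (mul_one r).symm⟩
  have hr0 : r ≠ 0 := by
    rintro rfl
    obtain ⟨q, hq, hqI⟩ := h0
    obtain ⟨s, hs⟩ := (hr q).1 hqI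
    exact hq (by simpa using hs)
  have hsurj : ∀ q ∉ I, ∀ y : M, ∃ x : M, op q • x = y := fun q hq =>
    ((h (op q)).resolve_left hq).1
  have hprime : ∀ p q, p * q ∈ I → p ∈ I ∨ q ∈ I := by
    intro p q hpq
    by_contra! hne
    apply hne.2
    intro y
    obtain ⟨x, rfl⟩ := hsurj p hne.1 y
    rw [← mul_smul, ← op_mul]
    exact hpq x
  have h1 : (1 : SkewPoly φ) ∉ I := by
    intro h1
    obtain ⟨x, hx⟩ := exists_ne (0 : M)
    exact hx (by simpa using h1 x)
  have hleft : ∀ p, ∀ q ∈ I, p * q ∈ I := fun p q hq x => by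
    rw [op_mul, mul_smul]
    exact hq _
  have hright : ∀ p, ∀ q ∈ I, q * p ∈ I := fun p q hq x => by
    rw [op_mul, mul_smul, hq, smul_zero]
  have hinv : ∀ p ∉ I, ∃ s, p * s - 1 ∈ I := by
    intro p hp
    obtain ⟨g, hg⟩ := SkewPoly.exists_eq_mul (Submodule.span (SkewPoly φ)ᵐᵒᵖ {p} ⊔ I)
    have hpg : p ∈ Submodule.span (SkewPoly φ)ᵐᵒᵖ {p} ⊔ I :=
      Submodule.mem_sup_left (Submodule.mem_span_singleton_self p)
    obtain ⟨s, hs⟩ := (hg p).1 hpg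
    obtain ⟨s', hs'⟩ := (hg r).1 (Submodule.mem_sup_right hrI)
    have hgI : g ∉ I := fun hgI => hp (hs ▸ hright s g hgI)
    have hsI : s' ∈ I := (hprime g s' (hs' ▸ hrI)).resolve_left hgI
    obtain ⟨u, rfl⟩ := (hr s').1 hsI
    -- Here `gR = pR + I` and `r = g * s'` with `s' ∈ I = rR`, so `r = g * r * u` and `g` has degree
    -- zero. Hence `pR + I` contains `1`.
    obtain ⟨g', hg'⟩ := (SkewPoly.isUnit_of_eq_mul_mul hr0 (by rw [mul_assoc]; exact hs')
      ).exists_right_inv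
    have : (1 : SkewPoly φ) ∈ Submodule.span (SkewPoly φ)ᵐᵒᵖ {p} ⊔ I :=
      (hg 1).2 ⟨g', hg'.symm⟩
    obtain ⟨y, hy, z, hz, hyz⟩ := Submodule.mem_sup.1 this
    obtain ⟨b, rfl⟩ := Submodule.mem_span_singleton.1 hy
    refine ⟨unop b, ?_⟩
    have : p * unop b - 1 = -z := by
      rw [← hyz]
      change p * unop b - (p * unop b + z) = -z
      abel
    rw [this]
    exact I.neg_mem hz
  refine ⟨r, ⟨fun hu => ?_, fun a b hab => ?_⟩, fun q => ?_, ⟨⟨0, 1, ?_⟩, fun x hx => ?_⟩,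
    moduleQuotientAnnihilator _ M, fun q x => rfl⟩
  · obtain ⟨s, hs⟩ := hu.exists_right_inv
    exact h1 (hs ▸ hright s r hrI)
  · rcases hprime a b (hab ▸ hrI) with ha | hb
    · right
      obtain ⟨u, rfl⟩ := (hr a).1 ha
      exact SkewPoly.isUnit_of_eq_mul_mul' hr0 hab
    · left
      obtain ⟨u, rfl⟩ := (hr b).1 hb
      exact SkewPoly.isUnit_of_eq_mul_mul hr0 (by rw [mul_assoc]; exact hab)
  · rw [mem_annihilatorIdeal, ← hmem, hr]
  · rw [← map_zero ((annihilatorIdeal (SkewPoly φ) M).ringCon.mk'),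
      ← map_one ((annihilatorIdeal (SkewPoly φ) M).ringCon.mk'), Ne, ringCon_mk'_eq_iff]
    intro hx
    exact h1 fun x => by rw [← hx]; simp
  -- Right inverses of all nonzero elements suffice: the right inverse `y` of `x` has its own right
  -- inverse, which must be `x`.
  · have hright_inv : ∀ x : (annihilatorIdeal (SkewPoly φ) M).ringCon.Quotient, x ≠ 0 →
        ∃ y, x * y = 1 := by
      intro x hx
      obtain ⟨p, rfl⟩ := RingCon.mk'_surjective _ x
      have hp : p ∉ I := by
        intro hp
        apply hx
        rw [← map_zero ((annihilatorIdeal (SkewPoly φ) M).ringCon.mk'), ringCon_mk'_eq_iff]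
        intro x
        rw [hp x, op_zero, zero_smul]
      obtain ⟨s, hs⟩ := hinv p hp
      refine ⟨(annihilatorIdeal (SkewPoly φ) M).ringCon.mk' s, ?_⟩
      rw [← map_mul, ← map_one ((annihilatorIdeal (SkewPoly φ) M).ringCon.mk'),
        ringCon_mk'_eq_iff]
      intro x
      have := hs x
      rwa [op_sub, sub_smul, sub_eq_zero] at this
    obtain ⟨y, hy⟩ := hright_inv x hx
    by_cases hy0 : y = 0
    · have hz : (1 : (annihilatorIdeal (SkewPoly φ) M).ringCon.Quotient) = 0 := by
        rw [← hy, hy0, mul_zero]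
      exact absurd (by rw [← mul_one x, hz, mul_zero]) hx
    obtain ⟨z, hz⟩ := hright_inv y hy0
    have : x = z := by rw [← mul_one x, ← hz, ← mul_assoc, hy, one_mul]
    exact isUnit_iff_exists.2 ⟨y, hy, this ▸ hz⟩

theorem zeroOrSurjectiveFiniteKernel_iff [Nontrivial M] :
    ZeroOrSurjectiveFiniteKernel (SkewPoly φ)ᵐᵒᵖ M ↔
      (IsDivisibleModule (SkewPoly φ) M ∧ ∀ r : SkewPoly φ, r ≠ 0 → (ann M r).Finite) ∨
      IsVectorSpaceModuloIrreducible (SkewPoly φ) M := by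
  refine ⟨fun h => ?_, fun h => h.elim (fun h => zeroOrSurjectiveFiniteKernel_of_isDivisible h.1 h.2)
    zeroOrSurjectiveFiniteKernel_of_isVectorSpace⟩
  by_cases h0 : ∃ q : SkewPoly φ, q ≠ 0 ∧ ∀ x : M, op q • x = 0
  · exact Or.inr (isVectorSpaceModuloIrreducible h h0)
  · left
    push Not at h0
    have key : ∀ r : SkewPoly φ, r ≠ 0 → _ := fun r hr => (h (op r)).resolve_left fun h' =>
      (h0 r hr).elim fun x hx => hx (h' x)
    exact ⟨fun r hr => (key r hr).1, fun r hr => (key r hr).2⟩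

end Action

open FirstOrder FirstOrder.Language FirstOrder.Language.Structure

/-! ### Quantifier-free definable sets for the trivial `C`-relation. -/

section QuantifierFree

/-- The ternary relation of the trivial valuation. -/
def HasTrivialC (U : Type v) [cLang.Structure U] : Prop :=
  ∀ x y z : U, cRel U x y z ↔ x ≠ y ∧ y = z

variable {U : Type v} [cLang.Structure U]

theorem HasTrivialC.isCRelation (h : HasTrivialC U) : IsCRelation (cRel U) where
  symm x y z := by simp only [h x y z, h x z y]; grind
  asymm x y z := by simp only [h x y z, h y x z]; grind
  trans x y z w := by simp only [h x y z, h w y z, h x w z]; grind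
  of_ne x y hxy := (h x y y).2 ⟨hxy, rfl⟩

theorem isQFDefinableFromC_of_finite {S : Set U} (hS : S.Finite) : IsQFDefinableFromC S := by
  induction S, hS using Set.Finite.induction_on with
  | empty => exact ⟨⊥, BoundedFormula.isQF_bot, by ext; simp⟩
  | @insert u S _ _ ih =>
    obtain ⟨ψ, hψ, rfl⟩ := ih
    refine ⟨Term.equal (Term.var (Sum.inr ())) (Term.var (Sum.inl u)) ⊔ ψ,
      ((BoundedFormula.IsAtomic.equal _ _).isQF).sup hψ, ?_⟩
    ext x
    simp [Formula.realize_sup, Formula.realize_equal]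

theorem IsQFDefinableFromC.compl {S : Set U} (h : IsQFDefinableFromC S) :
    IsQFDefinableFromC Sᶜ := by
  obtain ⟨ψ, hψ, rfl⟩ := h
  exact ⟨∼ψ, hψ.not, by ext x; simp [Formula.realize_not]⟩

theorem isQFDefinableFromC_of_finite_or_cofinite {S : Set U} (hS : S.Finite ∨ Sᶜ.Finite) :
    IsQFDefinableFromC S :=
  hS.elim isQFDefinableFromC_of_finite fun h => by
    simpa using (isQFDefinableFromC_of_finite h).compl

theorem finite_or_cofinite_compl {X : Type*} {S : Set X} (h : S.Finite ∨ Sᶜ.Finite) :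
    Sᶜ.Finite ∨ Sᶜᶜ.Finite := by
  rw [compl_compl]; exact h.symm

theorem finite_or_cofinite_union {X : Type*} {S S' : Set X} (h : S.Finite ∨ Sᶜ.Finite)
    (h' : S'.Finite ∨ S'ᶜ.Finite) : (S ∪ S').Finite ∨ (S ∪ S')ᶜ.Finite := by
  rw [Set.compl_union]
  rcases h with h | h
  · rcases h' with h' | h'
    · exact Or.inl (h.union h')
    · exact Or.inr (h'.subset Set.inter_subset_right)
  · exact Or.inr (h.subset Set.inter_subset_left)

theorem finite_or_cofinite_setOf_realize_eq (t t' : cLang.Term ((U ⊕ Unit) ⊕ Fin 0)) :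
    {x : U | t.realize (Sum.elim (Sum.elim id fun _ => x) default) =
      t'.realize (Sum.elim (Sum.elim id fun _ => x) default)}.Finite ∨
    {x : U | t.realize (Sum.elim (Sum.elim id fun _ => x) default) =
      t'.realize (Sum.elim (Sum.elim id fun _ => x) default)}ᶜ.Finite := by
  rcases t with ((a | a) | a) | ⟨f, _⟩
  · rcases t' with ((b | b) | b) | ⟨f, _⟩
    · by_cases h : a = b
      · right; simp [h]
      · left; simp [h]
    · left
      simp only [Term.realize_var, Sum.elim_inl, Sum.elim_inr, id]
      exact (Set.finite_singleton a).subset fun x hx => hx.symm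
    · exact b.elim0
    · exact f.elim
  · rcases t' with ((b | b) | b) | ⟨f, _⟩
    · left
      simp only [Term.realize_var, Sum.elim_inl, Sum.elim_inr, id]
      exact (Set.finite_singleton b).subset fun x hx => hx
    · right; simp
    · exact b.elim0
    · exact f.elim
  · exact a.elim0
  · exact f.elim

/-- For the trivial relation, atomic formulas reduce to equalities between the variable and
parameters, and finite or cofinite sets form a Boolean algebra. -/
theorem IsQFDefinableFromC.finite_or_cofinite (hC : HasTrivialC U) {S : Set U}
    (h : IsQFDefinableFromC S) : S.Finite ∨ Sᶜ.Finite := by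
  obtain ⟨ψ, hψ, rfl⟩ := h
  have key : ∀ ψ : cLang.BoundedFormula (U ⊕ Unit) 0, ψ.IsQF →
      {x : U | ψ.Realize (Sum.elim id fun _ => x) default}.Finite ∨
      {x : U | ψ.Realize (Sum.elim id fun _ => x) default}ᶜ.Finite := by
    intro ψ hψ
    induction hψ with
    | falsum => exact Or.inl (Set.finite_empty.subset fun _ hx => False.elim hx)
    | of_isAtomic h =>
      cases h with
      | equal t t' =>
        simp only [BoundedFormula.realize_bdEqual]
        exact finite_or_cofinite_setOf_realize_eq t t'
      | @rel l R ts =>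
        cases R
        have h : ∀ x : U, (BoundedFormula.rel (L := cLang) CRelSymbol.C ts).Realize
            (Sum.elim id fun _ => x) default ↔
            ¬ (ts 0).realize (Sum.elim (Sum.elim id fun _ => x) default) =
              (ts 1).realize (Sum.elim (Sum.elim id fun _ => x) default) ∧
            (ts 1).realize (Sum.elim (Sum.elim id fun _ => x) default) =
              (ts 2).realize (Sum.elim (Sum.elim id fun _ => x) default) := by
          intro x
          refine Iff.trans (iff_of_eq (congrArg (RelMap (L := cLang) CRelSymbol.C) ?_)) (hC _ _ _)
          ext i
          fin_cases i <;> rfl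
        have heq := Set.ext (a := {x : U | (BoundedFormula.rel (L := cLang) CRelSymbol.C ts).Realize
            (Sum.elim id fun _ => x) default}) h
        have := finite_or_cofinite_compl (finite_or_cofinite_union
          (finite_or_cofinite_setOf_realize_eq (ts 0) (ts 1))
          (finite_or_cofinite_compl (finite_or_cofinite_setOf_realize_eq (ts 1) (ts 2))))
        rw [Set.compl_union, compl_compl] at this
        exact Eq.subst (motive := fun S => S.Finite ∨ Sᶜ.Finite) heq.symm this
    | @imp ψ ψ' _ _ h h' =>
      have := finite_or_cofinite_union (finite_or_cofinite_compl h) h'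
      have heq : {x : U | (ψ.imp ψ').Realize (Sum.elim id fun _ => x) default} =
          {x : U | ψ.Realize (Sum.elim id fun _ => x) default}ᶜ ∪
          {x : U | ψ'.Realize (Sum.elim id fun _ => x) default} := by
        ext x
        simp only [BoundedFormula.realize_imp, Set.mem_union, Set.mem_compl_iff,
          Set.mem_ofPred_eq]
        tauto
      rwa [heq]
  exact key ψ hψ

end QuantifierFree

/-! ### Quantifier elimination for modules with the trivial `C`-relation. -/

section Elimination

variable {R : Type u} [Ring R] {U : Type v} [AddCommGroup U] [Module Rᵐᵒᵖ U]

/-- The span of the coordinate functions. -/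
def coordinateSpan (R : Type u) [Ring R] (U : Type v) [AddCommGroup U] [Module Rᵐᵒᵖ U]
    (α : Type w) (n : ℕ) : Submodule Rᵐᵒᵖ ((α → U) × (Fin n → U) → U) :=
  Submodule.span Rᵐᵒᵖ (Set.range fun (i : α ⊕ Fin n) p => Sum.elim p.1 p.2 i)

variable [inst : ((moduleLang R).sum cLang).Structure U]

theorem realize_mem_coordinateSpan
    (hU : (LHom.sumInl : moduleLang R →ᴸ (moduleLang R).sum cLang).reduct U = moduleStructure R U)
    {α : Type w} {n : ℕ} (t : ((moduleLang R).sum cLang).Term (α ⊕ Fin n)) :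
    (fun p : (α → U) × (Fin n → U) => t.realize (Sum.elim p.1 p.2)) ∈
      coordinateSpan R U α n := by
  induction t with
  | var i => exact Submodule.subset_span ⟨i, rfl⟩
  | @func l f ts ih =>
    rcases f with f | f
    · have hf : ∀ x : Fin l → U, inst.funMap (Sum.inl f) x = (moduleStructure R U).funMap f x :=
        fun x => by rw [← hU]; rfl
      cases f with
      | zero =>
        have h : (fun p : (α → U) × (Fin n → U) => inst.funMap (Sum.inl ModuleFunc.zero)
          fun i => (ts i).realize (Sum.elim p.1 p.2)) = 0 := funext fun p => hf _
        exact Eq.subst (motive := (· ∈ coordinateSpan R U α n)) h.symm (zero_mem _)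
      | neg =>
        have h : (fun p : (α → U) × (Fin n → U) => inst.funMap (Sum.inl ModuleFunc.neg)
          fun i => (ts i).realize (Sum.elim p.1 p.2)) =
            -fun p => (ts 0).realize (Sum.elim p.1 p.2) := funext fun p => hf _
        exact Eq.subst (motive := (· ∈ coordinateSpan R U α n)) h.symm (neg_mem (ih 0))
      | smul r =>
        have h : (fun p : (α → U) × (Fin n → U) => inst.funMap (Sum.inl (ModuleFunc.smul r))
          fun i => (ts i).realize (Sum.elim p.1 p.2)) =
            op r • fun p => (ts 0).realize (Sum.elim p.1 p.2) := funext fun p => hf _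
        exact Eq.subst (motive := (· ∈ coordinateSpan R U α n)) h.symm (Submodule.smul_mem _ _ (ih 0))
      | add =>
        have h : (fun p : (α → U) × (Fin n → U) => inst.funMap (Sum.inl ModuleFunc.add)
          fun i => (ts i).realize (Sum.elim p.1 p.2)) =
            (fun p => (ts 0).realize (Sum.elim p.1 p.2)) +
            fun p => (ts 1).realize (Sum.elim p.1 p.2) := funext fun p => hf _
        exact Eq.subst (motive := (· ∈ coordinateSpan R U α n)) h.symm (add_mem (ih 0) (ih 1))
    · exact f.elim

/-- Terms are linear forms in the coordinates, so atomic formulas are Boolean combinations of linear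
equations; `∀` is treated as `¬∃¬` by integrating out the last variable. -/
theorem isSimpleSet_realize [Infinite U] [IsPrincipalIdealRing Rᵐᵒᵖ]
    (hU : (LHom.sumInl : moduleLang R →ᴸ (moduleLang R).sum cLang).reduct U = moduleStructure R U)
    (hC : @HasTrivialC U (cReduct (moduleLang R) U)) (hR : ZeroOrSurjectiveFiniteKernel Rᵐᵒᵖ U)
    {α : Type w} {n : ℕ} (ψ : ((moduleLang R).sum cLang).BoundedFormula α n) :
    IsSimpleSet (coordinateSpan R U α n) {p | ψ.Realize p.1 p.2} := by
  have heq : ∀ {n} (t t' : ((moduleLang R).sum cLang).Term (α ⊕ Fin n)),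
      IsSimpleSet (coordinateSpan R U α n)
        {p | t.realize (Sum.elim p.1 p.2) = t'.realize (Sum.elim p.1 p.2)} := by
    intro n t t'
    simpa only [Pi.sub_apply, sub_eq_zero] using IsSimpleSet.of_eq_zero
      (sub_mem (realize_mem_coordinateSpan hU t) (realize_mem_coordinateSpan hU t'))
  induction ψ with
  | @falsum n =>
    have : IsSimpleSet (coordinateSpan R U α n) Set.univ := by
      simpa using IsSimpleSet.of_eq_zero (zero_mem (coordinateSpan R U α n))
    have h : {p : (α → U) × (Fin n → U) | (BoundedFormula.falsum
        (L := (moduleLang R).sum cLang)).Realize p.1 p.2} = Set.univᶜ := by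
      rw [Set.compl_univ]
      exact Set.eq_empty_of_forall_notMem fun _ hx => hx
    exact h ▸ this.compl
  | equal t t' => exact heq t t'
  | @rel n l S ts =>
    rcases S with S | S
    · exact S.elim
    · cases S
      have h : {p : (α → U) × (Fin n → U) | (BoundedFormula.rel
          (L := (moduleLang R).sum cLang) (Sum.inr CRelSymbol.C) ts).Realize p.1 p.2} =
          {p | (ts 0).realize (Sum.elim p.1 p.2) = (ts 1).realize (Sum.elim p.1 p.2)}ᶜ ∩
          {p | (ts 1).realize (Sum.elim p.1 p.2) = (ts 2).realize (Sum.elim p.1 p.2)} := by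
        ext p
        refine Iff.trans ?_ (hC ((ts 0).realize (Sum.elim p.1 p.2))
          ((ts 1).realize (Sum.elim p.1 p.2)) ((ts 2).realize (Sum.elim p.1 p.2)))
        refine iff_of_eq (congrArg (inst.RelMap (Sum.inr CRelSymbol.C)) ?_)
        ext i
        fin_cases i <;> rfl
      rw [h]
      exact (heq _ _).compl.inter (heq _ _)
  | imp ψ ψ' h h' =>
    have := h.compl.union h'
    convert this using 1
    ext p
    simp only [BoundedFormula.realize_imp, Set.mem_union, Set.mem_compl_iff, Set.mem_ofPred_eq]
    tauto
  | @all n ψ h =>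
    have := (IsSimpleSet.exists hR (T := coordinateSpan R U α n)
      (e := fun p y => (p.1, Fin.snoc p.2 y)) ?_ h.compl).compl
    · convert this using 1
      ext p
      simp [BoundedFormula.realize_all]
    · intro g hg
      induction hg using Submodule.span_induction with
      | zero => exact ⟨0, zero_mem _, 0, by simp⟩
      | add f g _ _ hf hg =>
        obtain ⟨f', hf', a, ha⟩ := hf
        obtain ⟨g', hg', b, hb⟩ := hg
        exact ⟨f' + g', add_mem hf' hg', a + b, fun x y => by
          simp only [Pi.add_apply, ha, hb, add_smul]; abel⟩
      | smul b f _ hf =>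
        obtain ⟨f', hf', a, ha⟩ := hf
        exact ⟨b • f', Submodule.smul_mem _ _ hf', b * a, fun x y => by
          simp only [Pi.smul_apply, ha, smul_add, mul_smul]⟩
      | mem f hf =>
        obtain ⟨i | i, rfl⟩ := hf
        · exact ⟨_, Submodule.subset_span ⟨Sum.inl i, rfl⟩, 0, by simp⟩
        · refine Fin.lastCases ?_ (fun i => ?_) i
          · exact ⟨0, zero_mem _, 1, by simp⟩
          · exact ⟨_, Submodule.subset_span ⟨Sum.inr i, rfl⟩, 0, by simp⟩

theorem finite_or_cofinite_of_definable [Infinite U] [IsPrincipalIdealRing Rᵐᵒᵖ]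
    (hU : (LHom.sumInl : moduleLang R →ᴸ (moduleLang R).sum cLang).reduct U = moduleStructure R U)
    (hC : @HasTrivialC U (cReduct (moduleLang R) U)) (hR : ZeroOrSurjectiveFiniteKernel Rᵐᵒᵖ U)
    {S : Set U} (hS : (Set.univ : Set U).Definable₁ ((moduleLang R).sum cLang) S) :
    S.Finite ∨ Sᶜ.Finite := by
  obtain ⟨ψ, hψ⟩ := Set.definable_iff_exists_formula_sum.1 hS
  have := (isSimpleSet_realize hU hC hR ψ).finite_or_cofinite hR
    -- The parameters keep their own values and the single free variable takes the value `y`, so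
    -- linear forms restrict to `u + a • y`.
    (e := fun y => (Sum.elim (↑) fun _ => y, default)) ?_
  · have h : S = (fun y => ((Sum.elim (↑) fun _ => y, default) :
        (↥(Set.univ : Set U) ⊕ Fin 1 → U) × (Fin 0 → U))) ⁻¹'
          {p | BoundedFormula.Realize ψ p.1 p.2} := by
      ext x
      exact Set.ext_iff.1 hψ fun _ => x
    rwa [h]
  · intro g hg
    induction hg using Submodule.span_induction with
    | zero => exact ⟨0, 0, by simp⟩
    | add f g _ _ hf hg =>
      obtain ⟨f', a, ha⟩ := hf
      obtain ⟨g', b, hb⟩ := hg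
      exact ⟨f' + g', a + b, fun y => by simp only [Pi.add_apply, ha, hb, add_smul]; abel⟩
    | smul b f _ hf =>
      obtain ⟨f', a, ha⟩ := hf
      exact ⟨b • f', b * a, fun y => by simp only [Pi.smul_apply, ha, smul_add, mul_smul]⟩
    | mem f hf =>
      obtain ⟨(i | i) | i, rfl⟩ := hf
      · exact ⟨i, 0, by simp⟩
      · exact ⟨0, 1, by simp⟩
      · exact i.elim0

end Elimination

/-! ### Transfer of sentences along elementary equivalence. -/

namespace FirstOrder.Language

variable {L : FirstOrder.Language.{a, b}}

/-- The sentence that `ψ` holds for all values of the variables. -/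
def universalClosure {α : Type*} [Finite α] (ψ : L.Formula α) : L.Sentence :=
  (ψ.relabel (Sum.inr : α → Empty ⊕ α)).iAlls α

theorem realize_universalClosure {M : Type v} [L.Structure M] {α : Type*} [Finite α]
    {ψ : L.Formula α} : M ⊨ universalClosure ψ ↔ ∀ v : α → M, ψ.Realize v := by
  simp only [universalClosure, Sentence.Realize, Formula.realize_iAlls, Formula.realize_relabel]
  rfl

end FirstOrder.Language

namespace FirstOrder.Language.ElementarilyEquivalent

variable {L : FirstOrder.Language.{a, b}} {M : Type v} {N : Type w} [L.Structure M] [L.Structure N]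

theorem forall_realize (h : L.ElementarilyEquivalent M N) {α : Type*} [Finite α]
    (ψ : L.Formula α) (hM : ∀ v : α → M, ψ.Realize v) (v : α → N) : ψ.Realize v := by
  have := (h.realize_sentence _).1 (realize_universalClosure.2 hM)
  exact realize_universalClosure.1 this v

theorem forall_exists_realize (h : L.ElementarilyEquivalent M N) {α β : Type*} [Finite α]
    [Finite β] (ψ : L.Formula (α ⊕ β)) (hM : ∀ v : α → M, ∃ x : β → M, ψ.Realize (Sum.elim v x))
    (v : α → N) : ∃ x : β → N, ψ.Realize (Sum.elim v x) := by
  have := h.forall_realize (ψ.iExs β) (fun v => Formula.realize_iExs.2 (hM v)) v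
  exact Formula.realize_iExs.1 this

theorem exists_forall_realize (h : L.ElementarilyEquivalent M N) {α β : Type*} [Finite α]
    [Finite β] (ψ : L.Formula (α ⊕ β)) (hM : ∃ v : α → M, ∀ x : β → M, ψ.Realize (Sum.elim v x)) :
    ∃ v : α → N, ∀ x : β → N, ψ.Realize (Sum.elim v x) := by
  by_contra! hN
  obtain ⟨v, hv⟩ := hM
  -- A failure in `N` is a `∀∃` statement about `∼ψ`, which goes back to `M`.
  obtain ⟨x, hx⟩ := h.symm.forall_exists_realize (∼ψ) (fun v => (hN v).imp fun _ hx => hx) v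
  exact hx (hv x)

theorem realize_eq_realize (h : L.ElementarilyEquivalent M N) {α : Type*} [Finite α]
    (t t' : L.Term α) (hM : ∀ v : α → M, t.realize v = t'.realize v) (v : α → N) :
    t.realize v = t'.realize v :=
  Formula.realize_equal.1 (h.forall_realize (t.equal t') (fun v => Formula.realize_equal.2 (hM v)) v)

theorem reduct {L' : FirstOrder.Language} {M : Type v} {N : Type w} [L'.Structure M] [L'.Structure N]
    (h : L'.ElementarilyEquivalent M N) (f : L →ᴸ L') :
    @ElementarilyEquivalent L M N (f.reduct M) (f.reduct N) := by
  let := f.reduct M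
  let := f.reduct N
  rw [elementarilyEquivalent_iff]
  intro ψ
  rw [← f.realize_onSentence M, ← f.realize_onSentence N]
  exact h.realize_sentence _

end FirstOrder.Language.ElementarilyEquivalent

/-! ### Modules as first-order structures. -/

section Modules

variable {R : Type u} [Ring R] {α : Type*}

/-- The term `t + t'`. -/
def addTerm (t t' : (moduleLang R).Term α) : (moduleLang R).Term α :=
  Functions.apply₂ (L := moduleLang R) ModuleFunc.add t t'

/-- The term `-t`. -/
def negTerm (t : (moduleLang R).Term α) : (moduleLang R).Term α :=
  Functions.apply₁ (L := moduleLang R) ModuleFunc.neg t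

/-- The term `t.r`. -/
def smulTerm (r : R) (t : (moduleLang R).Term α) : (moduleLang R).Term α :=
  Functions.apply₁ (L := moduleLang R) (ModuleFunc.smul r) t

/-- The term `0`. -/
def zeroTerm : (moduleLang R).Term α :=
  Constants.term (L := moduleLang R) ModuleFunc.zero

/-- Every structure elementarily equivalent to a module is a module. -/
theorem exists_module_of_elementarilyEquivalent {M : Type v} [AddCommGroup M] [Module Rᵐᵒᵖ M]
    {N : Type w} [inst : (moduleLang R).Structure N]
    (h : (moduleLang R).ElementarilyEquivalent M N) :
    ∃ (_ : AddCommGroup N) (_ : Module Rᵐᵒᵖ N), inst = moduleStructure R N := by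
  -- The operations are read off from the given structure, so that it is the module structure on
  -- `N`; each module axiom is an identity between terms, inherited from `M`.
  let : Zero N := ⟨inst.funMap ModuleFunc.zero ![]⟩
  let : Add N := ⟨fun x y => inst.funMap ModuleFunc.add ![x, y]⟩
  let : Neg N := ⟨fun x => inst.funMap ModuleFunc.neg ![x]⟩
  let : SMul Rᵐᵒᵖ N := ⟨fun r x => inst.funMap (ModuleFunc.smul (unop r)) ![x]⟩
  have hadd : ∀ {k} (t t' : (moduleLang R).Term (Fin k)) (v : Fin k → N),
      (addTerm t t').realize v = t.realize v + t'.realize v :=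
    fun t t' v => Term.realize_functions_apply₂
  have hneg : ∀ {k} (t : (moduleLang R).Term (Fin k)) (v : Fin k → N),
      (negTerm t).realize v = - t.realize v :=
    fun t v => Term.realize_functions_apply₁
  have hsmul : ∀ {k} (r : R) (t : (moduleLang R).Term (Fin k)) (v : Fin k → N),
      (smulTerm r t).realize v = op r • t.realize v :=
    fun r t v => Term.realize_functions_apply₁
  have hzero : ∀ {k} (v : Fin k → N), (zeroTerm (R := R)).realize v = 0 :=
    fun v => congrArg (inst.funMap ModuleFunc.zero) (Subsingleton.elim _ _)
  have hadd' : ∀ {k} (t t' : (moduleLang R).Term (Fin k)) (v : Fin k → M),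
      (addTerm t t').realize v = t.realize v + t'.realize v :=
    fun t t' v => Term.realize_functions_apply₂
  have hneg' : ∀ {k} (t : (moduleLang R).Term (Fin k)) (v : Fin k → M),
      (negTerm t).realize v = - t.realize v :=
    fun t v => Term.realize_functions_apply₁
  have hsmul' : ∀ {k} (r : R) (t : (moduleLang R).Term (Fin k)) (v : Fin k → M),
      (smulTerm r t).realize v = op r • t.realize v :=
    fun r t v => Term.realize_functions_apply₁
  have hzero' : ∀ {k} (v : Fin k → M), (zeroTerm (R := R)).realize v = 0 :=
    fun v => rfl
  have key : ∀ {k} (t t' : (moduleLang R).Term (Fin k)),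
      (∀ v : Fin k → M, t.realize v = t'.realize v) → ∀ v : Fin k → N,
        t.realize v = t'.realize v := fun t t' => h.realize_eq_realize t t'
  let : AddGroup N := AddGroup.ofLeftAxioms
    (fun x y z => by
      have := key (addTerm (addTerm (.var 0) (.var 1)) (.var 2))
        (addTerm (.var 0) (addTerm (.var 1) (.var 2)))
        (fun v => by simp only [hadd', add_assoc]) ![x, y, z]
      simpa [hadd] using this)
    (fun x => by
      have := key (addTerm zeroTerm (.var 0)) (.var 0)
        (fun v => by simp only [hadd', hzero', zero_add]) ![x]
      simpa [hadd, hzero] using this)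
    (fun x => by
      have := key (addTerm (negTerm (.var 0)) (.var 0)) zeroTerm
        (fun v => by simp only [hadd', hneg', hzero', neg_add_cancel]) ![x]
      simpa [hadd, hneg, hzero] using this)
  let : AddCommGroup N :=
    { add_comm := fun x y => by
        have := key (addTerm (.var 0) (.var 1)) (addTerm (.var 1) (.var 0))
          (fun v => by simp only [hadd', add_comm]) ![x, y]
        simpa [hadd] using this }
  let : Module Rᵐᵒᵖ N := Module.ofMinimalAxioms
    (fun r x y => by
      have := key (smulTerm (unop r) (addTerm (.var 0) (.var 1)))
        (addTerm (smulTerm (unop r) (.var 0)) (smulTerm (unop r) (.var 1)))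
        (fun v => by simp only [hadd', hsmul', smul_add]) ![x, y]
      simpa [hadd, hsmul] using this)
    (fun r s x => by
      have := key (smulTerm (unop r + unop s) (.var 0))
        (addTerm (smulTerm (unop r) (.var 0)) (smulTerm (unop s) (.var 0)))
        (fun v => by simp only [hadd', hsmul', op_add, add_smul]) ![x]
      simpa [hadd, hsmul] using this)
    (fun r s x => by
      have := key (smulTerm (unop s * unop r) (.var 0))
        (smulTerm (unop r) (smulTerm (unop s) (.var 0)))
        (fun v => by simp only [hsmul', op_mul, mul_smul]) ![x]
      simpa [hsmul] using this)
    (fun x => by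
      have := key (smulTerm 1 (.var 0)) (.var 0)
        (fun v => by simp only [hsmul', op_one, one_smul]) ![x]
      simpa [hsmul] using this)
  refine ⟨inferInstance, inferInstance, Structure.ext ?_ ?_⟩
  · funext k f x
    cases f with
    | zero => exact congrArg (inst.funMap ModuleFunc.zero) (Subsingleton.elim _ _)
    | neg => exact congrArg (inst.funMap ModuleFunc.neg) (by ext i; fin_cases i; rfl)
    | smul r => exact congrArg (inst.funMap (ModuleFunc.smul r)) (by ext i; fin_cases i; rfl)
    | add => exact congrArg (inst.funMap ModuleFunc.add) (by ext i; fin_cases i <;> rfl)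
  · funext k r
    exact r.elim

theorem realize_smulTerm {N : Type w} [AddCommGroup N] [Module Rᵐᵒᵖ N] (r : R)
    (t : (moduleLang R).Term α) (v : α → N) : (smulTerm r t).realize v = op r • t.realize v :=
  Term.realize_functions_apply₁

theorem realize_zeroTerm {N : Type w} [AddCommGroup N] [Module Rᵐᵒᵖ N] (v : α → N) :
    (zeroTerm (R := R)).realize v = 0 :=
  rfl

/-- For each scalar, acting as zero is an identity and surjectivity is a `∀∃` sentence. Finiteness
of the kernel becomes first-order once its number `k` of elements in `M` is fixed: some `k`-tuple
lists every solution. -/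
theorem ZeroOrSurjectiveFiniteKernel.of_elementarilyEquivalent {M : Type v} [AddCommGroup M]
    [Module Rᵐᵒᵖ M] {N : Type w} [AddCommGroup N] [Module Rᵐᵒᵖ N]
    (h : (moduleLang R).ElementarilyEquivalent M N) (hM : ZeroOrSurjectiveFiniteKernel Rᵐᵒᵖ M) :
    ZeroOrSurjectiveFiniteKernel Rᵐᵒᵖ N := by
  intro r
  rcases hM r with h0 | ⟨hsurj, hfin⟩
  · left
    intro y
    have := h.realize_eq_realize (smulTerm (unop r) (.var ())) zeroTerm
      (fun v => by simp [realize_smulTerm, realize_zeroTerm, h0]) fun _ => y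
    simpa [realize_smulTerm, realize_zeroTerm] using this
  · right
    constructor
    · intro y
      obtain ⟨x, hx⟩ := h.forall_exists_realize (α := Unit) (β := Unit)
        ((smulTerm (unop r) (.var (Sum.inr ()))).equal (.var (Sum.inl ())))
        (fun v => by
          obtain ⟨x, hx⟩ := hsurj (v ())
          exact ⟨fun _ => x, by simpa [Formula.realize_equal, realize_smulTerm] using hx⟩)
        fun _ => y
      exact ⟨x (), by simpa [Formula.realize_equal, realize_smulTerm] using hx⟩
    · obtain ⟨k, f, -, hf⟩ := hfin.fin_param
      have hrange : ∀ x : M, r • x = 0 → ∃ i, x = f i := fun x hx => by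
        have : x ∈ Set.range f := hf ▸ hx
        exact this.imp fun _ h => h.symm
      obtain ⟨g, hg⟩ := h.exists_forall_realize (α := Fin k) (β := Unit)
        (((smulTerm (unop r) (.var (Sum.inr ()))).equal zeroTerm).imp
          (Formula.iSup fun i : Fin k => Term.equal (.var (Sum.inr ())) (.var (Sum.inl i))))
        ⟨f, fun x => by
          simpa [Formula.realize_equal, realize_smulTerm, realize_zeroTerm] using hrange (x ())⟩
      refine (Set.finite_range g).subset fun x hx => ?_
      have := hg fun _ => x
      simp only [Formula.realize_imp, Formula.realize_equal, realize_smulTerm, realize_zeroTerm,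
        Formula.realize_iSup, Term.realize_var, Sum.elim_inl, Sum.elim_inr] at this
      exact (this hx).imp fun _ h => h.symm

/-- A proper subgroup has a coset inside its complement, so a finite complement forces the subgroup
itself to be finite. -/
theorem addSubgroup_finite_or_eq_top {M : Type v} [AddCommGroup M] (H : AddSubgroup M)
    (hH : (H : Set M).Finite ∨ (H : Set M)ᶜ.Finite) : (H : Set M).Finite ∨ ∀ x, x ∈ H := by
  rw [or_iff_not_imp_right]
  intro hx
  push Not at hx
  obtain ⟨x, hx⟩ := hx
  refine hH.elim id fun hc => ?_
  refine Set.Finite.of_injOn (f := (x + ·)) (t := (H : Set M)ᶜ) (fun y hy hxy => hx ?_)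
    (add_right_injective x).injOn hc
  simpa using H.sub_mem hxy hy

theorem zeroOrSurjectiveFiniteKernel_of_finite_or_cofinite {M : Type v} [AddCommGroup M]
    [Module Rᵐᵒᵖ M] [Infinite M]
    (h : ∀ ψ : (moduleLang R).Formula Unit, {x : M | ψ.Realize fun _ => x}.Finite ∨
      {x : M | ψ.Realize fun _ => x}ᶜ.Finite) : ZeroOrSurjectiveFiniteKernel Rᵐᵒᵖ M := by
  intro r
  let f : M →+ M := DistribSMul.toAddMonoidHom M r
  have hker : {x : M | ((smulTerm (unop r) (.var ())).equal zeroTerm :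
      (moduleLang R).Formula Unit).Realize fun _ => x} = (f.ker : Set M) := by
    ext x
    simp [Formula.realize_equal, realize_smulTerm, realize_zeroTerm, f]
  have hrange : {x : M | (((smulTerm (unop r) (.var (Sum.inr ()))).equal (.var (Sum.inl ())) :
      (moduleLang R).Formula (Unit ⊕ Unit)).iExs Unit).Realize fun _ => x} =
        (f.range : Set M) := by
    ext x
    simp only [Set.mem_ofPred_eq, Formula.realize_iExs, Formula.realize_equal, realize_smulTerm,
      Term.realize_var, Sum.elim_inl, Sum.elim_inr]
    exact ⟨fun ⟨y, hy⟩ => ⟨y (), hy⟩, fun ⟨y, hy⟩ => ⟨fun _ => y, hy⟩⟩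
  rcases addSubgroup_finite_or_eq_top f.ker (hker ▸ h _) with hfin | htop
  · right
    refine ⟨?_, hfin⟩
    refine (addSubgroup_finite_or_eq_top f.range (hrange ▸ h _)).resolve_left fun hr => ?_
    -- A finite image together with finite fibres, which are empty or cosets of the kernel, would
    -- make `M` finite.
    have : (f ⁻¹' (f.range : Set M)).Finite := by
      refine hr.preimage' fun y _ => ?_
      rcases (f ⁻¹' {y}).eq_empty_or_nonempty with he | ⟨x, hx⟩
      · rw [he]; exact Set.finite_empty
      · refine (hfin.image (x + ·)).subset fun z hz => ⟨z - x, ?_, by simp⟩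
        have hx' : f x = y := hx
        have hz' : f z = y := hz
        simp [AddMonoidHom.mem_ker, hx', hz']
    exact Set.infinite_univ (this.subset fun x _ => ⟨x, rfl⟩)
  · exact Or.inl htop

end Modules

/-- The definition quantifies over structures in the universe `max a b v`, so it is applied to an
isomorphic lift of `M` and the result is pulled back. -/
theorem IsStronglyMinimal.finite_or_cofinite {L : FirstOrder.Language.{a, b}} {M : Type v} [L.Structure M]
    (h : IsStronglyMinimal L M) (ψ : L.Formula Unit) :
    {x : M | ψ.Realize fun _ => x}.Finite ∨ {x : M | ψ.Realize fun _ => x}ᶜ.Finite := by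
  let e : M ≃ ULift.{max a b v} M := Equiv.ulift.symm
  let : L.Structure (ULift.{max a b v} M) := e.inducedStructure
  let E : M ≃[L] ULift.{max a b v} M := e.inducedStructureEquiv
  have hE : ∀ x, E x = e x := fun _ => rfl
  have hreal : ∀ x : M, ψ.Realize (fun _ => e x) ↔ ψ.Realize fun _ => x := fun x =>
    StrongHomClass.realize_formula E ψ (v := fun _ => x)
  have hdef : (Set.univ : Set (ULift.{max a b v} M)).Definable₁ L {x | ψ.Realize fun _ => x} := by
    refine Set.Definable.mono (A := ∅) (Set.empty_definable_iff.2
      ⟨ψ.relabel fun _ => 0, ?_⟩) (Set.empty_subset _)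
    ext x
    simp only [Set.mem_ofPred_eq, Formula.realize_relabel]
    rfl
  have hpre : {x : M | ψ.Realize fun _ => x} = e ⁻¹' {x | ψ.Realize fun _ => x} := by
    ext x
    exact (hreal x).symm
  rw [hpre, ← Set.preimage_compl]
  exact (h _ (StrongHomClass.elementarilyEquivalent E) _ hdef).imp
    (fun h => h.preimage e.injective.injOn) (fun h => h.preimage e.injective.injOn)

/-! ### Trivially valued modules and the conclusion. -/

namespace ValuedModule

variable {K : Type u} [Field K] {φ : K →+* K} {M : Type v} [AddCommGroup M]
  [Module (SkewPoly φ)ᵐᵒᵖ M] {Δ : Type w} [LinearOrder Δ] [OrderTop Δ]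

theorem IsTriviallyValued.C_iff {V : ValuedModule φ M Δ} (hV : V.IsTriviallyValued) (x y z : M) :
    V.C x y z ↔ x ≠ y ∧ y = z := by
  -- Two distinct values on nonzero elements, together with `⊤`, would make three.
  have hval : ∀ x y : M, x ≠ 0 → y ≠ 0 → V.val x = V.val y := by
    intro x y hx hy
    by_contra hne
    have hsub : ({⊤, V.val x, V.val y} : Set Δ) ⊆ Set.range V.val := by
      rintro _ (rfl | rfl | rfl)
      · exact ⟨0, (V.val_eq_top 0).2 rfl⟩
      · exact ⟨x, rfl⟩
      · exact ⟨y, rfl⟩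
    have hcard : ({⊤, V.val x, V.val y} : Set Δ).encard = 3 :=
      Set.encard_eq_three.2 ⟨_, _, _, fun h => hx ((V.val_eq_top x).1 h.symm),
        fun h => hy ((V.val_eq_top y).1 h.symm), hne, rfl⟩
    have := (Set.encard_le_encard hsub).trans hV
    rw [hcard] at this
    exact absurd this (by decide)
  unfold C
  constructor
  · rintro ⟨h, h'⟩
    have hxz : x - z ≠ 0 := fun h0 => not_top_lt ((V.val_eq_top _).2 h0 ▸ h')
    have hxy : x - y ≠ 0 := fun h0 => hxz ((V.val_eq_top _).1 (h ▸ (V.val_eq_top _).2 h0))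
    refine ⟨fun h0 => hxy (sub_eq_zero.2 h0), ?_⟩
    by_contra hyz
    exact absurd (hval _ _ hxz (sub_ne_zero.2 hyz)) h'.ne
  · rintro ⟨hxy, rfl⟩
    refine ⟨rfl, ?_⟩
    rw [sub_self, (V.val_eq_top 0).2 rfl, lt_top_iff_ne_top, Ne, V.val_eq_top, sub_eq_zero]
    exact hxy

end ValuedModule

/-- The formula `C(x, y, z) ↔ x ≠ y ∧ y = z`. -/
def trivialCFormula : cLang.Formula (Fin 3) :=
  (Relations.formula (L := cLang) CRelSymbol.C fun i => Term.var i).iff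
    (∼(Term.equal (.var 0) (.var 1)) ⊓ Term.equal (.var 1) (.var 2))

theorem realize_trivialCFormula {U : Type v} [cLang.Structure U] {x : Fin 3 → U} :
    trivialCFormula.Realize x ↔ (cRel U (x 0) (x 1) (x 2) ↔ x 0 ≠ x 1 ∧ x 1 = x 2) := by
  have hx : ![x 0, x 1, x 2] = x := by
    ext i
    fin_cases i <;> rfl
  have hC : (Relations.formula (L := cLang) CRelSymbol.C fun i => Term.var i).Realize x ↔
      cRel U (x 0) (x 1) (x 2) := by
    rw [cRel, hx]
    rfl
  rw [trivialCFormula, Formula.realize_iff, hC]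
  simp [Formula.realize_inf, Formula.realize_not, Formula.realize_equal]

theorem HasTrivialC.of_elementarilyEquivalent {L : FirstOrder.Language.{a, b}} {M : Type v}
    {N : Type w} [(L.sum cLang).Structure M] [(L.sum cLang).Structure N]
    (hM : @HasTrivialC M (cReduct L M)) (h : (L.sum cLang).ElementarilyEquivalent M N) :
    @HasTrivialC N (cReduct L N) := by
  have h' := h.reduct (LHom.sumInr : cLang →ᴸ L.sum cLang)
  let : cLang.Structure M := cReduct L M
  let : cLang.Structure N := cReduct L N
  intro x y z
  exact realize_trivialCFormula.1
    (h'.forall_realize trivialCFormula (fun v => realize_trivialCFormula.2 (hM _ _ _)) ![x, y, z])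

namespace ValuedModule

variable {K : Type u} [Field K] {φ : K →+* K} {M : Type v} [AddCommGroup M]
  [Module (SkewPoly φ)ᵐᵒᵖ M] {Δ : Type w} [LinearOrder Δ] [OrderTop Δ]

theorem IsTriviallyValued.hasTrivialC {V : ValuedModule φ M Δ} (hV : V.IsTriviallyValued) :
    @HasTrivialC M (@cReduct (moduleLang (SkewPoly φ)) M V.toStructure) :=
  hV.C_iff

theorem finite_or_cofinite_of_elementarilyEquivalent [Infinite M] {V : ValuedModule φ M Δ}
    (hV : V.IsTriviallyValued) (hM : ZeroOrSurjectiveFiniteKernel (SkewPoly φ)ᵐᵒᵖ M)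
    (N : Type a) [((moduleLang (SkewPoly φ)).sum cLang).Structure N]
    (h : @ElementarilyEquivalent ((moduleLang (SkewPoly φ)).sum cLang) M N V.toStructure _)
    (S : Set N) (hS : (Set.univ : Set N).Definable₁ ((moduleLang (SkewPoly φ)).sum cLang) S) :
    S.Finite ∨ Sᶜ.Finite := by
  let := V.toStructure
  have hC := hV.hasTrivialC.of_elementarilyEquivalent h
  have hN : Infinite N := h.infinite
  have h' := h.reduct (LHom.sumInl : moduleLang (SkewPoly φ) →ᴸ _)
  let : (moduleLang (SkewPoly φ)).Structure N :=
    (LHom.sumInl : moduleLang (SkewPoly φ) →ᴸ (moduleLang (SkewPoly φ)).sum cLang).reduct N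
  obtain ⟨_, _, hst⟩ := exists_module_of_elementarilyEquivalent (N := N) h'
  exact finite_or_cofinite_of_definable hst hC
    (hM.of_elementarilyEquivalent (N := N) (hst ▸ h')) hS

theorem cMinimal_of_zeroOrSurjectiveFiniteKernel [Infinite M] {V : ValuedModule φ M Δ}
    (hV : V.IsTriviallyValued) (hM : ZeroOrSurjectiveFiniteKernel (SkewPoly φ)ᵐᵒᵖ M) :
    V.CMinimal :=
  let := V.toStructure
  ⟨@HasTrivialC.isCRelation M (cReduct (moduleLang (SkewPoly φ)) M) hV.hasTrivialC,
    fun N _ h S hS => @isQFDefinableFromC_of_finite_or_cofinite N (cReduct _ N) S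
      (finite_or_cofinite_of_elementarilyEquivalent hV hM N h S hS)⟩

/-- The trivial `C`-relation persists in every elementarily equivalent structure, so the expansion
by `C` is strongly minimal; formulas of the pure module language are then a special case. -/
theorem CMinimal.zeroOrSurjectiveFiniteKernel [Infinite M] {V : ValuedModule φ M Δ}
    (hV : V.IsTriviallyValued) (h : V.CMinimal) :
    ZeroOrSurjectiveFiniteKernel (SkewPoly φ)ᵐᵒᵖ M := by
  let := V.toStructure
  have h' : IsStronglyMinimal ((moduleLang (SkewPoly φ)).sum cLang) M := fun N _ hN S hS =>
    @IsQFDefinableFromC.finite_or_cofinite N (cReduct (moduleLang (SkewPoly φ)) N)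
      (hV.hasTrivialC.of_elementarilyEquivalent hN) S (h.2 N hN S hS)
  refine zeroOrSurjectiveFiniteKernel_of_finite_or_cofinite fun ψ => ?_
  simpa only [LHom.realize_onFormula] using h'.finite_or_cofinite (LHom.sumInl.onFormula ψ)

end ValuedModule

theorem isStronglyMinimal_of_zeroOrSurjectiveFiniteKernel {R : Type u} [Ring R]
    [IsPrincipalIdealRing Rᵐᵒᵖ] {M : Type v} [AddCommGroup M] [Module Rᵐᵒᵖ M] [Infinite M]
    (hM : ZeroOrSurjectiveFiniteKernel Rᵐᵒᵖ M) : IsStronglyMinimal (moduleLang R) M := by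
  intro N inst h S hS
  obtain ⟨_, _, rfl⟩ := exists_module_of_elementarilyEquivalent h
  have hN : Infinite N := h.infinite
  -- Expanding `N` by the trivial relation allows the elimination result for the larger language to
  -- be reused.
  let : cLang.Structure N := cStructure fun x y z => x ≠ y ∧ y = z
  exact finite_or_cofinite_of_definable (R := R) rfl (fun _ _ _ => Iff.rfl)
    (hM.of_elementarilyEquivalent h) (Set.Definable.map_expansion hS LHom.sumInl)

theorem zeroOrSurjectiveFiniteKernel_of_isStronglyMinimal {R : Type u} [Ring R] {M : Type v}
    [AddCommGroup M] [Module Rᵐᵒᵖ M] [Infinite M] (h : IsStronglyMinimal (moduleLang R) M) :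
    ZeroOrSurjectiveFiniteKernel Rᵐᵒᵖ M :=
  zeroOrSurjectiveFiniteKernel_of_finite_or_cofinite h.finite_or_cofinite

end

theorem mainTheorem3 {K : Type u} [Field K] (φ : K →+* K)
    (M : Type v) [AddCommGroup M] [Module (SkewPoly φ)ᵐᵒᵖ M] [Infinite M]
    (Δ : Type w) [LinearOrder Δ] [OrderTop Δ]
    (V : ValuedModule φ M Δ) (hV : V.IsTriviallyValued) :
    (V.CMinimal ↔ IsStronglyMinimal (moduleLang (SkewPoly φ)) M) ∧
    (V.CMinimal ↔
      (IsDivisibleModule (SkewPoly φ) M ∧ ∀ r : SkewPoly φ, r ≠ 0 → (ann M r).Finite) ∨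
      IsVectorSpaceModuloIrreducible (SkewPoly φ) M) := by
  have h : V.CMinimal ↔ ZeroOrSurjectiveFiniteKernel (SkewPoly φ)ᵐᵒᵖ M :=
    ⟨ValuedModule.CMinimal.zeroOrSurjectiveFiniteKernel hV,
      ValuedModule.cMinimal_of_zeroOrSurjectiveFiniteKernel hV⟩
  exact ⟨h.trans ⟨isStronglyMinimal_of_zeroOrSurjectiveFiniteKernel,
    zeroOrSurjectiveFiniteKernel_of_isStronglyMinimal⟩, h.trans zeroOrSurjectiveFiniteKernel_iff⟩
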